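/- Let $\mathbb H$ be the real quaternions. For a matrix $A$ over $\mathbb H$ let $r(A)$ be its rank (the maximal number of right linearly independent columns), let $A^\dagger$ be its Moore–Penrose inverse, i.e. the unique $X$ with $AXA=A$, $XAX=X$, $(AX)^*=AX$, $(XA)^*=XA$, and put $L_A=I-A^\dagger A$, $R_A=I-AA^\dagger$. Let $A_i,B_i,C_i$ ($i=1,\dots,4$) be given quaternion matrices of arbitrary sizes for which the system $$A_1X_1-X_2B_1=C_1,\quad A_2X_3-X_2B_2=C_2,\quad A_3X_3-X_4B_3=C_3,\quad A_4X_4-X_5B_4=C_4 \tag{$*$}$$ in the unknown matrices $X_1,\dots,X_5$ makes sense. Put $$A_{11}=R_{B_2}B_1,\quad B_{11}=R_{A_1}A_2,\quad C_{11}=B_1L_{A_{11}},\quad D_{11}=R_{A_1}(R_{A_2}C_2B_2^\dagger B_1-C_1)L_{A_{11}},$$ $$A_{22}=R_{(A_4A_3)}A_4,\quad B_{22}=R_{B_3}L_{B_4},\quad C_{22}=R_{(A_4A_3)}(A_4R_{A_3}C_3B_3^\dagger+C_4)L_{B_4},$$ $$A_{33}=(L_{A_2},\,-L_{A_3}),\quad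 B_{33}=\begin{pmatrix}R_{C_{11}}B_2\\-B_4B_3\end{pmatrix},\quad A_{44}=-L_{(A_4A_3)},$$ $$E_1=A_3^\dagger C_3+(A_4A_3)^\dagger(C_4B_3+A_4R_{A_3}C_3)-A_2^\dagger C_2-B_{11}^\dagger D_{11}C_{11}^\dagger B_2,$$ $$A=R_{A_{33}}L_{B_{11}},\quad B=B_2L_{B_{33}},\quad C=R_{A_{33}}A_{44},\quad D=B_3L_{B_{33}},\quad E=R_{A_{33}}E_1L_{B_{33}},$$ $$M=R_AC,\quad N=DL_B,\quad S=CL_M.$$ **Theorem 3.1.** The following statements are equivalent. (1) The system $(*)$ is consistent (has a solution). (2) The following rank equalities hold: $$r\begin{pmatrix}C_i&A_i\\B_i&0\end{pmatrix}=r(A_i)+r(B_i)\quad(i=1,2,3,4),$$ $$r\begin{pmatrix}C_1&C_2&A_1&A_2\\B_1&B_2&0&0\end{pmatrix}=r(A_1,\,A_2)+r(B_1,\,B_2),$$ $$r\begin{pmatrix}A_4C_3+C_4B_3&A_4A_3\\B_4B_3&0\end{pmatrix}=r(A_4A_3)+r(B_4B_3),$$ $$r\begin{pmatrix}C_1&C_2&A_1&A_2\\0&A_4C_3+C_4B_3&0&A_4A_3\\B_1&B_2&0&0\\0&B_4B_3&0&0\end{pmatrix}=r\begin{pmatrix}A_1&A_2\\0&A_4A_3\end{pmatrix}+r\begin{pmatrix}B_1&B_2\\0&B_4B_3\end{pmatrix},$$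 $$r\begin{pmatrix}C_2&A_2\\C_3&A_3\\B_2&0\\B_3&0\end{pmatrix}=r\begin{pmatrix}A_2\\A_3\end{pmatrix}+r\begin{pmatrix}B_2\\B_3\end{pmatrix},$$ $$r\begin{pmatrix}C_1&C_2&A_1&A_2\\0&C_3&0&A_3\\B_1&B_2&0&0\\0&B_3&0&0\end{pmatrix}=r\begin{pmatrix}A_1&A_2\\0&A_3\end{pmatrix}+r\begin{pmatrix}B_1&B_2\\0&B_3\end{pmatrix},$$ $$r\begin{pmatrix}C_2&A_2\\A_4C_3+C_4B_3&A_4A_3\\B_2&0\\B_4B_3&0\end{pmatrix}=r\begin{pmatrix}A_2\\A_4A_3\end{pmatrix}+r\begin{pmatrix}B_2\\B_4B_3\end{pmatrix}.$$ (3) The following equalities hold: $$R_{A_2}C_2L_{B_2}=0,\quad D_{11}L_{C_{11}}=0,\quad R_{B_{11}}D_{11}=0,$$ $$R_{A_3}C_3L_{B_3}=0,\quad R_{A_{22}}C_{22}=0,\quad C_{22}L_{B_{22}}=0,$$ $$R_MR_AE=0,\quad EL_BL_N=0,\quad R_AEL_D=0,\quad R_CEL_B=0.$$ Moreover, if $(*)$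 is consistent, then its general solution is $$X_1=A_1^\dagger(C_1-R_{A_2}C_2B_2^\dagger B_1+A_2U_1B_1)+W_4A_{11}+L_{A_1}W_6,$$ $$X_2=-R_{A_2}C_2B_2^\dagger+A_2U_1+V_1R_{B_2},\qquad X_4=-R_{A_3}C_3B_3^\dagger+A_3U_2+V_2R_{B_3},$$ $$X_5=-R_{(A_4A_3)}(C_4+A_4R_{A_3}C_3B_3^\dagger-A_4V_2R_{B_3})B_4^\dagger+A_4A_3T_4+T_5R_{B_4},$$ $$X_3=A_2^\dagger C_2+U_1B_2+L_{A_2}W_1\quad\text{or equally}\quad X_3=A_3^\dagger C_3+U_2B_3+L_{A_3}T_1,$$ where $$U_1=B_{11}^\dagger D_{11}C_{11}^\dagger+L_{B_{11}}W_2+W_3R_{C_{11}},$$ $$V_1=-R_{A_1}(C_1-R_{A_2}C_2B_2^\dagger B_1+A_2U_1B_1)A_{11}^\dagger+A_1W_4+W_5R_{A_{11}},$$ $$V_2=A_{22}^\dagger C_{22}B_{22}^\dagger+L_{A_{22}}T_2+T_3R_{B_{22}},$$ $$U_2=(A_4A_3)^\dagger(C_4+A_4R_{A_3}C_3B_3^\dagger-A_4V_2R_{B_3})+T_4B_4+L_{(A_4A_3)}T_6,$$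 $$W_1=(I_{p_1},\,0)\,[A_{33}^\dagger(E_1-L_{B_{11}}W_2B_2-A_{44}T_6B_3)-A_{33}^\dagger Z_7B_{33}+L_{A_{33}}Z_6],$$ $$T_1=(0,\,I_{p_2})\,[A_{33}^\dagger(E_1-L_{B_{11}}W_2B_2-A_{44}T_6B_3)-A_{33}^\dagger Z_7B_{33}+L_{A_{33}}Z_6],$$ $$W_3=[R_{A_{33}}(E_1-L_{B_{11}}W_2B_2-A_{44}T_6B_3)B_{33}^\dagger+A_{33}A_{33}^\dagger Z_7+Z_8R_{B_{33}}]\begin{pmatrix}I_{p_3}\\0\end{pmatrix},$$ $$T_4=[R_{A_{33}}(E_1-L_{B_{11}}W_2B_2-A_{44}T_6B_3)B_{33}^\dagger+A_{33}A_{33}^\dagger Z_7+Z_8R_{B_{33}}]\begin{pmatrix}0\\I_{p_4}\end{pmatrix},$$ $$W_2=A^\dagger EB^\dagger-A^\dagger CM^\dagger EB^\dagger-A^\dagger SC^\dagger EN^\dagger DB^\dagger-A^\dagger SZ_1R_NDB^\dagger+L_AZ_2+Z_3R_B,$$ $$T_6=M^\dagger ED^\dagger+S^\dagger SC^\dagger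 EN^\dagger+L_ML_SZ_4+L_MZ_1R_N+Z_5R_D;$$ here $p_1,p_2$ are the numbers of columns of $A_2,A_3$ (so $p_1=p_2$), $p_3,p_4$ are the numbers of rows of $B_1,B_4$, and the remaining matrices $W_4,W_5,W_6,T_2,T_3,T_5,Z_1,\dots,Z_8$ over $\mathbb H$ are arbitrary, of the appropriate sizes. That is, for every choice of these matrices the two expressions for $X_3$ coincide and $(X_1,\dots,X_5)$ is a solution of $(*)$, and every solution of $(*)$ arises in this way. -/

import Mathlib

open scoped Matrix Quaternion

namespace QuaternionMatrix

/-- The rank of a quaternion matrix: the dimension of its right column space, that is, the maximal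
number of right linearly independent columns. Right scalar multiplication by `ℍ` is the action of
the opposite ring. -/
noncomputable def rank {m n : Type*} (A : Matrix m n ℍ[ℝ]) : ℕ :=
  Module.finrank ℍ[ℝ]ᵐᵒᵖ (Submodule.span ℍ[ℝ]ᵐᵒᵖ (Set.range A.col))

/-! Existence and uniqueness of the Moore-Penrose inverse. -/

open Polynomial in
theorem exists_regular {n : Type*} [Fintype n] [DecidableEq n] (H : Matrix n n ℍ[ℝ])
    (hc : ∀ Z : Matrix n n ℍ[ℝ], H * (H * Z) = 0 → H * Z = 0) :
    ∃ Y : Matrix n n ℍ[ℝ], H * Y * H = H := by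
  have hint : IsIntegral ℝ H := IsIntegral.of_finite ℝ H
  obtain ⟨q, hq, hndvd⟩ := exists_eq_pow_rootMultiplicity_mul_and_not_dvd (minpoly ℝ H)
    (minpoly.ne_zero hint) 0
  have h0 := minpoly.aeval ℝ H
  rw [hq] at h0
  simp only [map_zero, sub_zero, map_mul, map_pow, aeval_X] at h0 hndvd
  have hc0 : q.coeff 0 ≠ 0 := fun h => hndvd (X_dvd_iff.2 h)
  have red : ∀ (k : ℕ) (Z : Matrix n n ℍ[ℝ]), H ^ k * Z = 0 → H * Z = 0 := by
    intro k
    induction k with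
    | zero => intro Z hZ; simp only [pow_zero, one_mul] at hZ; simp [hZ]
    | succ k ih =>
      intro Z hZ
      rw [pow_succ, mul_assoc] at hZ
      exact hc Z (ih _ hZ)
  have h1 := red _ _ h0
  rw [← divX_mul_X_add q] at h1
  simp only [map_add, map_mul, aeval_X, aeval_C, mul_add, Algebra.algebraMap_eq_smul_one,
    mul_smul_comm, mul_one] at h1
  refine ⟨-((q.coeff 0)⁻¹ • aeval H q.divX), ?_⟩
  rw [← mul_assoc] at h1
  have h2 := eq_neg_of_add_eq_zero_left h1
  rw [mul_neg, neg_mul, mul_smul_comm, smul_mul_assoc, h2, smul_neg, neg_neg, smul_smul,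
    inv_mul_cancel₀ hc0, one_smul]

theorem eq_zero_of_conjTranspose_mul_self {m n : Type*} [Fintype m] (A : Matrix m n ℍ[ℝ]) (h : Aᴴ * A = 0) : A = 0 := by
  ext1 i j
  have h1 := congrFun (congrFun h j) j
  simp only [Matrix.mul_apply, Matrix.conjTranspose_apply, Quaternion.star_mul_self,
    Matrix.zero_apply] at h1
  have h2 : ∑ x, Quaternion.normSq (A x j) = 0 := by
    rw [← Quaternion.coe_inj, Quaternion.coe_zero, ← h1]
    exact map_sum (algebraMap ℝ ℍ[ℝ]) _ _
  have h3 := (Finset.sum_eq_zero_iff_of_nonneg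
    (fun x _ => Quaternion.normSq_nonneg)).1 h2 i (Finset.mem_univ _)
  simpa using h3

theorem exists_left {m n : Type*} [Fintype m] [Fintype n] [DecidableEq n] (A : Matrix m n ℍ[ℝ]) :
    ∃ G : Matrix n m ℍ[ℝ], A * G * A = A ∧ (A * G)ᴴ = A * G := by
  have key : ∀ Z : Matrix n n ℍ[ℝ], Aᴴ * A * Z = 0 → A * Z = 0 := by
    intro Z hZ
    apply eq_zero_of_conjTranspose_mul_self
    rw [Matrix.conjTranspose_mul, Matrix.mul_assoc, ← Matrix.mul_assoc Aᴴ, hZ, Matrix.mul_zero]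
  have hself : (Aᴴ * A)ᴴ = Aᴴ * A := by simp
  obtain ⟨Y, hY⟩ := exists_regular (Aᴴ * A) (by
    intro Z hZ
    apply eq_zero_of_conjTranspose_mul_self
    rw [Matrix.conjTranspose_mul, hself, Matrix.mul_assoc, hZ, Matrix.mul_zero])
  have h1 : A * (Y * Aᴴ) * A = A := by
    have := key (Y * (Aᴴ * A) - 1) (by
      rw [Matrix.mul_sub, ← Matrix.mul_assoc, hY, Matrix.mul_one, sub_self])
    rw [Matrix.mul_sub, Matrix.mul_one, sub_eq_zero] at this
    simpa only [Matrix.mul_assoc] using this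
  refine ⟨Y * Aᴴ, h1, ?_⟩
  have hY' : Aᴴ * A * Yᴴ * (Aᴴ * A) = Aᴴ * A := by
    have := congrArg Matrix.conjTranspose hY
    simpa only [Matrix.conjTranspose_mul, Matrix.conjTranspose_conjTranspose,
      Matrix.mul_assoc] using this
  have h2 : A * (Yᴴ * Aᴴ) * A = A := by
    have := key (Yᴴ * (Aᴴ * A) - 1) (by
      rw [Matrix.mul_sub, ← Matrix.mul_assoc, hY', Matrix.mul_one, sub_self])
    rw [Matrix.mul_sub, Matrix.mul_one, sub_eq_zero] at this
    simpa only [Matrix.mul_assoc] using this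
  have e1 : (A * (Y * Aᴴ))ᴴ = A * (Yᴴ * Aᴴ) := by
    simp [Matrix.conjTranspose_mul, Matrix.mul_assoc]
  rw [e1, ← sub_eq_zero]
  apply eq_zero_of_conjTranspose_mul_self
  have e2 : (A * (Yᴴ * Aᴴ) - A * (Y * Aᴴ))ᴴ = (A * (Y * Aᴴ) - A * (Yᴴ * Aᴴ)) := by
    simp [Matrix.conjTranspose_mul, Matrix.mul_assoc]
  have e3 : A * (Yᴴ * Aᴴ) - A * (Y * Aᴴ) = A * ((Yᴴ - Y) * Aᴴ) := by
    rw [Matrix.sub_mul, Matrix.mul_sub]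
  rw [e2, e3, ← Matrix.mul_assoc _ A, Matrix.sub_mul, h1, h2, sub_self, Matrix.zero_mul]

/-- `X` satisfies the four Penrose equations for `A`. -/
structure IsMoorePenrose {m n : Type*} [Fintype m] [Fintype n] (A : Matrix m n ℍ[ℝ]) (X : Matrix n m ℍ[ℝ]) : Prop where
  mul_mul_self : A * X * A = A
  self_mul_mul : X * A * X = X
  isHermitian_self_mul : (A * X)ᴴ = A * X
  isHermitian_mul_self : (X * A)ᴴ = X * A

theorem exists_isMoorePenrose {m n : Type*} [Fintype m] [Fintype n] [DecidableEq m]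
    [DecidableEq n] (A : Matrix m n ℍ[ℝ]) : ∃ X, IsMoorePenrose A X := by
  obtain ⟨G, h1, h2⟩ := exists_left A
  obtain ⟨K, h3, h4⟩ := exists_left Aᴴ
  have h5 : A * Kᴴ * A = A := by
    have := congrArg Matrix.conjTranspose h3
    simpa [Matrix.conjTranspose_mul, Matrix.mul_assoc] using this
  have h6 : (Kᴴ * A)ᴴ = Kᴴ * A := by
    rw [Matrix.conjTranspose_mul, Matrix.conjTranspose_conjTranspose, ← h4,
      Matrix.conjTranspose_mul, Matrix.conjTranspose_conjTranspose]
  have e1 : A * (Kᴴ * A * G) = A * G := by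
    rw [← Matrix.mul_assoc, ← Matrix.mul_assoc, h5]
  have e2 : Kᴴ * A * G * A = Kᴴ * A := by
    rw [Matrix.mul_assoc, Matrix.mul_assoc, ← Matrix.mul_assoc A, h1]
  refine ⟨Kᴴ * A * G, ?_, ?_, ?_, ?_⟩
  · rw [e1, h1]
  · rw [e2, Matrix.mul_assoc, e1, Matrix.mul_assoc]
  · rw [e1, h2]
  · rw [e2, h6]

theorem IsMoorePenrose.unique {m n : Type*} [Fintype m] [Fintype n] {A : Matrix m n ℍ[ℝ]} {X Y : Matrix n m ℍ[ℝ]}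
    (hX : IsMoorePenrose A X) (hY : IsMoorePenrose A Y) : X = Y := by
  have e1 : A * X = A * Y := by
    have : (A * X * (A * Y))ᴴ = (A * Y)ᴴ := by rw [← Matrix.mul_assoc, hX.mul_mul_self]
    rw [Matrix.conjTranspose_mul, hX.isHermitian_self_mul, hY.isHermitian_self_mul, ← Matrix.mul_assoc,
      hY.mul_mul_self] at this
    exact this
  have e2 : X * A = Y * A := by
    have : (X * A * (Y * A))ᴴ = (X * A)ᴴ := by
      rw [Matrix.mul_assoc, ← Matrix.mul_assoc A, hY.mul_mul_self]
    rw [Matrix.conjTranspose_mul, hX.isHermitian_mul_self, hY.isHermitian_mul_self, Matrix.mul_assoc,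
      ← Matrix.mul_assoc A, hX.mul_mul_self] at this
    exact this.symm
  rw [← hX.self_mul_mul, e2, Matrix.mul_assoc, e1, ← Matrix.mul_assoc, hY.self_mul_mul]

/-- The Moore-Penrose inverse, the unique solution of the four Penrose equations. -/
noncomputable def pinv {m n : Type*} [Fintype m] [Fintype n] [DecidableEq m] [DecidableEq n]
    (A : Matrix m n ℍ[ℝ]) : Matrix n m ℍ[ℝ] :=
  (exists_isMoorePenrose A).choose

theorem isMoorePenrose_pinv {m n : Type*} [Fintype m] [Fintype n] [DecidableEq m] [DecidableEq n]
    (A : Matrix m n ℍ[ℝ]) : IsMoorePenrose A (pinv A) :=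
  (exists_isMoorePenrose A).choose_spec

/-- The projector `L_A = I - A† A`. -/
noncomputable def projL {m n : Type*} [Fintype m] [Fintype n] [DecidableEq m] [DecidableEq n]
    (A : Matrix m n ℍ[ℝ]) : Matrix n n ℍ[ℝ] :=
  1 - pinv A * A

/-- The projector `R_A = I - A A†`. -/
noncomputable def projR {m n : Type*} [Fintype m] [Fintype n] [DecidableEq m] [DecidableEq n]
    (A : Matrix m n ℍ[ℝ]) : Matrix m m ℍ[ℝ] :=
  1 - A * pinv A

/-- The given matrices of the system
`A₁ X₁ - X₂ B₁ = C₁`, `A₂ X₃ - X₂ B₂ = C₂`, `A₃ X₃ - X₄ B₃ = C₃`, `A₄ X₄ - X₅ B₄ = C₄`,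
of arbitrary compatible sizes. -/
structure SylvesterSystem (m₁ m₃ m₄ n₁ p k₁ k₂ q s t : ℕ) where
  A₁ : Matrix (Fin m₁) (Fin n₁) ℍ[ℝ]
  A₂ : Matrix (Fin m₁) (Fin p) ℍ[ℝ]
  A₃ : Matrix (Fin m₃) (Fin p) ℍ[ℝ]
  A₄ : Matrix (Fin m₄) (Fin m₃) ℍ[ℝ]
  B₁ : Matrix (Fin q) (Fin k₁) ℍ[ℝ]
  B₂ : Matrix (Fin q) (Fin k₂) ℍ[ℝ]
  B₃ : Matrix (Fin s) (Fin k₂) ℍ[ℝ]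
  B₄ : Matrix (Fin t) (Fin s) ℍ[ℝ]
  C₁ : Matrix (Fin m₁) (Fin k₁) ℍ[ℝ]
  C₂ : Matrix (Fin m₁) (Fin k₂) ℍ[ℝ]
  C₃ : Matrix (Fin m₃) (Fin k₂) ℍ[ℝ]
  C₄ : Matrix (Fin m₄) (Fin s) ℍ[ℝ]

/-- The arbitrary matrices in the general solution. -/
structure FreeParameters (m₁ m₃ m₄ n₁ p k₁ k₂ q s t : ℕ) where
  W₄ : Matrix (Fin n₁) (Fin q) ℍ[ℝ]
  W₅ : Matrix (Fin m₁) (Fin q) ℍ[ℝ]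
  W₆ : Matrix (Fin n₁) (Fin k₁) ℍ[ℝ]
  T₂ : Matrix (Fin m₃) (Fin s) ℍ[ℝ]
  T₃ : Matrix (Fin m₃) (Fin s) ℍ[ℝ]
  T₅ : Matrix (Fin m₄) (Fin t) ℍ[ℝ]
  Z₁ : Matrix (Fin p) (Fin s) ℍ[ℝ]
  Z₂ : Matrix (Fin p) (Fin q) ℍ[ℝ]
  Z₃ : Matrix (Fin p) (Fin q) ℍ[ℝ]
  Z₄ : Matrix (Fin p) (Fin s) ℍ[ℝ]
  Z₅ : Matrix (Fin p) (Fin s) ℍ[ℝ]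
  Z₆ : Matrix (Fin p ⊕ Fin p) (Fin k₂) ℍ[ℝ]
  Z₇ : Matrix (Fin p) (Fin q ⊕ Fin t) ℍ[ℝ]
  Z₈ : Matrix (Fin p) (Fin q ⊕ Fin t) ℍ[ℝ]

namespace SylvesterSystem

section

variable {m₁ m₃ m₄ n₁ p k₁ k₂ q s t : ℕ} (G : SylvesterSystem m₁ m₃ m₄ n₁ p k₁ k₂ q s t)

def IsSolution (X₁ : Matrix (Fin n₁) (Fin k₁) ℍ[ℝ]) (X₂ : Matrix (Fin m₁) (Fin q) ℍ[ℝ])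
    (X₃ : Matrix (Fin p) (Fin k₂) ℍ[ℝ]) (X₄ : Matrix (Fin m₃) (Fin s) ℍ[ℝ])
    (X₅ : Matrix (Fin m₄) (Fin t) ℍ[ℝ]) : Prop :=
  G.A₁ * X₁ - X₂ * G.B₁ = G.C₁ ∧
  G.A₂ * X₃ - X₂ * G.B₂ = G.C₂ ∧
  G.A₃ * X₃ - X₄ * G.B₃ = G.C₃ ∧
  G.A₄ * X₄ - X₅ * G.B₄ = G.C₄

def IsConsistent : Prop :=
  ∃ X₁ X₂ X₃ X₄ X₅, G.IsSolution X₁ X₂ X₃ X₄ X₅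

/-! The rank conditions. `Matrix.fromBlocks P Q R S` is the block matrix with rows
`(P, Q)` and `(R, S)`; `fromCols P Q = (P, Q)`, and `fromRows P Q` puts `P` above `Q`. -/

open Matrix in
/-- The rank equalities: four for the single equations, then six for the coupled ones. -/
def RankConditions : Prop :=
  rank (fromBlocks G.C₁ G.A₁ G.B₁ 0) = rank G.A₁ + rank G.B₁ ∧
  rank (fromBlocks G.C₂ G.A₂ G.B₂ 0) = rank G.A₂ + rank G.B₂ ∧
  rank (fromBlocks G.C₃ G.A₃ G.B₃ 0) = rank G.A₃ + rank G.B₃ ∧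
  rank (fromBlocks G.C₄ G.A₄ G.B₄ 0) = rank G.A₄ + rank G.B₄ ∧
  rank (fromBlocks (fromCols G.C₁ G.C₂) (fromCols G.A₁ G.A₂) (fromCols G.B₁ G.B₂) 0) =
    rank (fromCols G.A₁ G.A₂) + rank (fromCols G.B₁ G.B₂) ∧
  rank (fromBlocks (G.A₄ * G.C₃ + G.C₄ * G.B₃) (G.A₄ * G.A₃) (G.B₄ * G.B₃) 0) =
    rank (G.A₄ * G.A₃) + rank (G.B₄ * G.B₃) ∧
  rank (fromBlocks
      (fromBlocks G.C₁ G.C₂ 0 (G.A₄ * G.C₃ + G.C₄ * G.B₃))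
      (fromBlocks G.A₁ G.A₂ 0 (G.A₄ * G.A₃))
      (fromBlocks G.B₁ G.B₂ 0 (G.B₄ * G.B₃)) 0) =
    rank (fromBlocks G.A₁ G.A₂ 0 (G.A₄ * G.A₃)) + rank (fromBlocks G.B₁ G.B₂ 0 (G.B₄ * G.B₃)) ∧
  rank (fromBlocks (fromRows G.C₂ G.C₃) (fromRows G.A₂ G.A₃) (fromRows G.B₂ G.B₃) 0) =
    rank (fromRows G.A₂ G.A₃) + rank (fromRows G.B₂ G.B₃) ∧
  rank (fromBlocks
      (fromBlocks G.C₁ G.C₂ 0 G.C₃)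
      (fromBlocks G.A₁ G.A₂ 0 G.A₃)
      (fromBlocks G.B₁ G.B₂ 0 G.B₃) 0) =
    rank (fromBlocks G.A₁ G.A₂ 0 G.A₃) + rank (fromBlocks G.B₁ G.B₂ 0 G.B₃) ∧
  rank (fromBlocks
      (fromRows G.C₂ (G.A₄ * G.C₃ + G.C₄ * G.B₃))
      (fromRows G.A₂ (G.A₄ * G.A₃))
      (fromRows G.B₂ (G.B₄ * G.B₃)) 0) =
    rank (fromRows G.A₂ (G.A₄ * G.A₃)) + rank (fromRows G.B₂ (G.B₄ * G.B₃))

/-! The auxiliary matrices built from the given ones. -/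

noncomputable def A₁₁ : Matrix (Fin q) (Fin k₁) ℍ[ℝ] := projR G.B₂ * G.B₁

noncomputable def B₁₁ : Matrix (Fin m₁) (Fin p) ℍ[ℝ] := projR G.A₁ * G.A₂

noncomputable def C₁₁ : Matrix (Fin q) (Fin k₁) ℍ[ℝ] := G.B₁ * projL G.A₁₁

noncomputable def D₁₁ : Matrix (Fin m₁) (Fin k₁) ℍ[ℝ] :=
  projR G.A₁ * (projR G.A₂ * G.C₂ * pinv G.B₂ * G.B₁ - G.C₁) * projL G.A₁₁

noncomputable def A₂₂ : Matrix (Fin m₄) (Fin m₃) ℍ[ℝ] := projR (G.A₄ * G.A₃) * G.A₄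

noncomputable def B₂₂ : Matrix (Fin s) (Fin s) ℍ[ℝ] := projR G.B₃ * projL G.B₄

noncomputable def C₂₂ : Matrix (Fin m₄) (Fin s) ℍ[ℝ] :=
  projR (G.A₄ * G.A₃) * (G.A₄ * projR G.A₃ * G.C₃ * pinv G.B₃ + G.C₄) * projL G.B₄

noncomputable def A₃₃ : Matrix (Fin p) (Fin p ⊕ Fin p) ℍ[ℝ] :=
  Matrix.fromCols (projL G.A₂) (-projL G.A₃)

noncomputable def B₃₃ : Matrix (Fin q ⊕ Fin t) (Fin k₂) ℍ[ℝ] :=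
  Matrix.fromRows (projR G.C₁₁ * G.B₂) (-(G.B₄ * G.B₃))

noncomputable def A₄₄ : Matrix (Fin p) (Fin p) ℍ[ℝ] := -projL (G.A₄ * G.A₃)

noncomputable def E₁ : Matrix (Fin p) (Fin k₂) ℍ[ℝ] :=
  pinv G.A₃ * G.C₃ + pinv (G.A₄ * G.A₃) * (G.C₄ * G.B₃ + G.A₄ * projR G.A₃ * G.C₃)
    - pinv G.A₂ * G.C₂ - pinv G.B₁₁ * G.D₁₁ * pinv G.C₁₁ * G.B₂

noncomputable def A : Matrix (Fin p) (Fin p) ℍ[ℝ] := projR G.A₃₃ * projL G.B₁₁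

noncomputable def B : Matrix (Fin q) (Fin k₂) ℍ[ℝ] := G.B₂ * projL G.B₃₃

noncomputable def C : Matrix (Fin p) (Fin p) ℍ[ℝ] := projR G.A₃₃ * G.A₄₄

noncomputable def D : Matrix (Fin s) (Fin k₂) ℍ[ℝ] := G.B₃ * projL G.B₃₃

noncomputable def E : Matrix (Fin p) (Fin k₂) ℍ[ℝ] := projR G.A₃₃ * G.E₁ * projL G.B₃₃

noncomputable def M : Matrix (Fin p) (Fin p) ℍ[ℝ] := projR G.A * G.C

noncomputable def N : Matrix (Fin s) (Fin k₂) ℍ[ℝ] := G.D * projL G.B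

noncomputable def S : Matrix (Fin p) (Fin p) ℍ[ℝ] := G.C * projL G.M

/-- The projector conditions. -/
def ProjectorConditions : Prop :=
  (projR G.A₂ * G.C₂ * projL G.B₂ = 0 ∧ G.D₁₁ * projL G.C₁₁ = 0 ∧ projR G.B₁₁ * G.D₁₁ = 0) ∧
  (projR G.A₃ * G.C₃ * projL G.B₃ = 0 ∧ projR G.A₂₂ * G.C₂₂ = 0 ∧ G.C₂₂ * projL G.B₂₂ = 0) ∧
  (projR G.M * projR G.A * G.E = 0 ∧ G.E * projL G.B * projL G.N = 0 ∧
    projR G.A * G.E * projL G.D = 0 ∧ projR G.C * G.E * projL G.B = 0)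

/-! The general solution, as a function of the arbitrary matrices `F`. -/

variable (F : FreeParameters m₁ m₃ m₄ n₁ p k₁ k₂ q s t)

noncomputable def W₂ : Matrix (Fin p) (Fin q) ℍ[ℝ] :=
  pinv G.A * G.E * pinv G.B
    - pinv G.A * G.C * pinv G.M * G.E * pinv G.B
    - pinv G.A * G.S * pinv G.C * G.E * pinv G.N * G.D * pinv G.B
    - pinv G.A * G.S * F.Z₁ * projR G.N * G.D * pinv G.B
    + projL G.A * F.Z₂ + F.Z₃ * projR G.B

noncomputable def T₆ : Matrix (Fin p) (Fin s) ℍ[ℝ] :=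
  pinv G.M * G.E * pinv G.D + pinv G.S * G.S * pinv G.C * G.E * pinv G.N
    + projL G.M * projL G.S * F.Z₄ + projL G.M * F.Z₁ * projR G.N + F.Z₅ * projR G.D

/-- The bracket in the formulas for `W₁` and `T₁`, the block column with blocks `W₁`, `T₁`. -/
noncomputable def WT₁ : Matrix (Fin p ⊕ Fin p) (Fin k₂) ℍ[ℝ] :=
  pinv G.A₃₃ * (G.E₁ - projL G.B₁₁ * G.W₂ F * G.B₂ - G.A₄₄ * G.T₆ F * G.B₃)
    - pinv G.A₃₃ * F.Z₇ * G.B₃₃ + projL G.A₃₃ * F.Z₆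

/-- The bracket in the formulas for `W₃` and `T₄`, the block row `(W₃, T₄)`. -/
noncomputable def WT₃ : Matrix (Fin p) (Fin q ⊕ Fin t) ℍ[ℝ] :=
  projR G.A₃₃ * (G.E₁ - projL G.B₁₁ * G.W₂ F * G.B₂ - G.A₄₄ * G.T₆ F * G.B₃) * pinv G.B₃₃
    + G.A₃₃ * pinv G.A₃₃ * F.Z₇ + F.Z₈ * projR G.B₃₃

noncomputable def W₁ : Matrix (Fin p) (Fin k₂) ℍ[ℝ] :=
  Matrix.fromCols (1 : Matrix (Fin p) (Fin p) ℍ[ℝ]) 0 * G.WT₁ F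

noncomputable def T₁ : Matrix (Fin p) (Fin k₂) ℍ[ℝ] :=
  Matrix.fromCols 0 (1 : Matrix (Fin p) (Fin p) ℍ[ℝ]) * G.WT₁ F

noncomputable def W₃ : Matrix (Fin p) (Fin q) ℍ[ℝ] :=
  G.WT₃ F * Matrix.fromRows (1 : Matrix (Fin q) (Fin q) ℍ[ℝ]) 0

noncomputable def T₄ : Matrix (Fin p) (Fin t) ℍ[ℝ] :=
  G.WT₃ F * Matrix.fromRows 0 (1 : Matrix (Fin t) (Fin t) ℍ[ℝ])

noncomputable def U₁ : Matrix (Fin p) (Fin q) ℍ[ℝ] :=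
  pinv G.B₁₁ * G.D₁₁ * pinv G.C₁₁ + projL G.B₁₁ * G.W₂ F + G.W₃ F * projR G.C₁₁

noncomputable def V₁ : Matrix (Fin m₁) (Fin q) ℍ[ℝ] :=
  -(projR G.A₁ * (G.C₁ - projR G.A₂ * G.C₂ * pinv G.B₂ * G.B₁ + G.A₂ * G.U₁ F * G.B₁)
      * pinv G.A₁₁) + G.A₁ * F.W₄ + F.W₅ * projR G.A₁₁

noncomputable def V₂ : Matrix (Fin m₃) (Fin s) ℍ[ℝ] :=
  pinv G.A₂₂ * G.C₂₂ * pinv G.B₂₂ + projL G.A₂₂ * F.T₂ + F.T₃ * projR G.B₂₂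

noncomputable def U₂ : Matrix (Fin p) (Fin s) ℍ[ℝ] :=
  pinv (G.A₄ * G.A₃) *
      (G.C₄ + G.A₄ * projR G.A₃ * G.C₃ * pinv G.B₃ - G.A₄ * G.V₂ F * projR G.B₃)
    + G.T₄ F * G.B₄ + projL (G.A₄ * G.A₃) * G.T₆ F

noncomputable def solX₁ : Matrix (Fin n₁) (Fin k₁) ℍ[ℝ] :=
  pinv G.A₁ * (G.C₁ - projR G.A₂ * G.C₂ * pinv G.B₂ * G.B₁ + G.A₂ * G.U₁ F * G.B₁)
    + F.W₄ * G.A₁₁ + projL G.A₁ * F.W₆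

noncomputable def solX₂ : Matrix (Fin m₁) (Fin q) ℍ[ℝ] :=
  -(projR G.A₂ * G.C₂ * pinv G.B₂) + G.A₂ * G.U₁ F + G.V₁ F * projR G.B₂

/-- The first expression for `X₃`. -/
noncomputable def solX₃ : Matrix (Fin p) (Fin k₂) ℍ[ℝ] :=
  pinv G.A₂ * G.C₂ + G.U₁ F * G.B₂ + projL G.A₂ * G.W₁ F

/-- The second expression for `X₃`. -/
noncomputable def altX₃ : Matrix (Fin p) (Fin k₂) ℍ[ℝ] :=
  pinv G.A₃ * G.C₃ + G.U₂ F * G.B₃ + projL G.A₃ * G.T₁ F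

noncomputable def solX₄ : Matrix (Fin m₃) (Fin s) ℍ[ℝ] :=
  -(projR G.A₃ * G.C₃ * pinv G.B₃) + G.A₃ * G.U₂ F + G.V₂ F * projR G.B₃

noncomputable def solX₅ : Matrix (Fin m₄) (Fin t) ℍ[ℝ] :=
  -(projR (G.A₄ * G.A₃) *
      (G.C₄ + G.A₄ * projR G.A₃ * G.C₃ * pinv G.B₃ - G.A₄ * G.V₂ F * projR G.B₃) * pinv G.B₄)
    + G.A₄ * G.A₃ * G.T₄ F + F.T₅ * projR G.B₄

end

end SylvesterSystem

end QuaternionMatrix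

/-! Everything rests on one equation: `A X - Y B = C` is solvable exactly when `R_A C L_B = 0`, and
then all its solutions are explicit (`sylvester_iff`). The companions `mul_mul_eq_iff` and
`mul_mul_add_mul_mul_iff` do the same for `A X B = C` and `A X B + C Y D = E`.

The system is a chain in which neighbouring equations share one unknown. The second and third
equations are solved first, giving `X₂, X₃` in terms of `U₁, V₁, W₁` and `X₄, X₃` in terms of `U₂,
V₂, T₁`. The first and fourth then become Sylvester equations again, and their solvability is `B₁₁
U₁ C₁₁ = D₁₁` and `A₂₂ V₂ B₂₂ = C₂₂`. Equating the two forms of `X₃` leaves one more Sylvester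
equation, in the blocks `(W₁; T₁)` and `(W₃, T₄)`, solvable exactly when `A W₂ B + C T₆ D = E`. Each
reduction is an equivalence, so the projector conditions yield both existence and the general
solution.

For the ranks, `rank_fromBlocks_zero_eq_iff` shows that `r (C A; B 0) = r(A) + r(B)` is again `R_A C
L_B = 0`. A solution of the system solves the block Sylvester equation behind each rank equality.
Conversely, such an equality means `u C v = 0` whenever `u A = 0` and `B v = 0`, and suitable `u, v`
produce every projector condition. -/

namespace QuaternionMatrix

/-! ### Identities for the Moore-Penrose inverse and its projectors -/

section Projectors

variable {m n o : Type*} [Fintype m] [Fintype n] [DecidableEq m] [DecidableEq n]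

theorem mul_pinv_mul (A : Matrix m n ℍ[ℝ]) : A * (pinv A * A) = A := by
  rw [← Matrix.mul_assoc, (isMoorePenrose_pinv A).mul_mul_self]

theorem pinv_mul_pinv (A : Matrix m n ℍ[ℝ]) : pinv A * (A * pinv A) = pinv A := by
  rw [← Matrix.mul_assoc, (isMoorePenrose_pinv A).self_mul_mul]

theorem mul_pinv_mul_assoc (A : Matrix m n ℍ[ℝ]) (X : Matrix n o ℍ[ℝ]) :
    A * (pinv A * (A * X)) = A * X := by
  simp only [← Matrix.mul_assoc, (isMoorePenrose_pinv A).mul_mul_self]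

theorem pinv_mul_pinv_assoc (A : Matrix m n ℍ[ℝ]) (X : Matrix m o ℍ[ℝ]) :
    pinv A * (A * (pinv A * X)) = pinv A * X := by
  simp only [← Matrix.mul_assoc, (isMoorePenrose_pinv A).self_mul_mul]

theorem projR_mul_self (A : Matrix m n ℍ[ℝ]) : projR A * A = 0 := by
  simp [projR, Matrix.sub_mul, Matrix.mul_assoc, mul_pinv_mul]

theorem mul_projL_self (A : Matrix m n ℍ[ℝ]) : A * projL A = 0 := by
  simp [projL, Matrix.mul_sub, mul_pinv_mul]

theorem projL_conjTranspose (A : Matrix m n ℍ[ℝ]) : (projL A)ᴴ = projL A := by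
  simp [projL, (isMoorePenrose_pinv A).isHermitian_mul_self, Matrix.conjTranspose_sub]

theorem projR_conjTranspose (A : Matrix m n ℍ[ℝ]) : (projR A)ᴴ = projR A := by
  simp [projR, (isMoorePenrose_pinv A).isHermitian_self_mul, Matrix.conjTranspose_sub]

/-- A left factor fixing `A` and Hermitian is absorbed by `A†` from the right. -/
theorem pinv_mul_of_mul_eq {A : Matrix m n ℍ[ℝ]} {P : Matrix m m ℍ[ℝ]} (hP : Pᴴ = P)
    (h : P * A = A) : pinv A * P = pinv A := by
  have h1 : (A * pinv A) * P = A * pinv A := by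
    have h2 : P * (A * pinv A) = A * pinv A := by rw [← Matrix.mul_assoc, h]
    have h3 := congrArg Matrix.conjTranspose h2
    rwa [Matrix.conjTranspose_mul, hP, (isMoorePenrose_pinv A).isHermitian_self_mul] at h3
  rw [← pinv_mul_pinv, Matrix.mul_assoc, h1]

theorem mul_pinv_of_mul_eq {A : Matrix m n ℍ[ℝ]} {P : Matrix n n ℍ[ℝ]} (hP : Pᴴ = P)
    (h : A * P = A) : P * pinv A = pinv A := by
  have h1 : P * (pinv A * A) = pinv A * A := by
    have h2 : (pinv A * A) * P = pinv A * A := by rw [Matrix.mul_assoc, h]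
    have h3 := congrArg Matrix.conjTranspose h2
    rwa [Matrix.conjTranspose_mul, hP, (isMoorePenrose_pinv A).isHermitian_mul_self] at h3
  rw [← pinv_mul_pinv, ← Matrix.mul_assoc (pinv A), ← Matrix.mul_assoc, h1]

theorem projR_mul_projR (A : Matrix m n ℍ[ℝ]) : projR A * projR A = projR A := by
  simp [projR, Matrix.sub_mul, Matrix.mul_sub, Matrix.mul_assoc, pinv_mul_pinv]

theorem projL_mul_projL (A : Matrix m n ℍ[ℝ]) : projL A * projL A = projL A := by
  simp [projL, Matrix.sub_mul, Matrix.mul_sub, Matrix.mul_assoc, pinv_mul_pinv_assoc]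

theorem projR_mul_self_assoc (A : Matrix m n ℍ[ℝ]) (X : Matrix n o ℍ[ℝ]) :
    projR A * (A * X) = 0 := by
  rw [← Matrix.mul_assoc, projR_mul_self, Matrix.zero_mul]

theorem mul_projL_self_assoc (A : Matrix m n ℍ[ℝ]) (X : Matrix n o ℍ[ℝ]) :
    A * (projL A * X) = 0 := by
  rw [← Matrix.mul_assoc, mul_projL_self, Matrix.zero_mul]

/-- A matrix annihilated by `R_A` from the left factors through `A`. -/
theorem mul_pinv_mul_of_projR_mul_eq_zero {A : Matrix m n ℍ[ℝ]} {X : Matrix m o ℍ[ℝ]}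
    (h : projR A * X = 0) : A * (pinv A * X) = X := by
  rw [projR, Matrix.sub_mul, Matrix.one_mul, sub_eq_zero, Matrix.mul_assoc] at h
  exact h.symm

theorem mul_pinv_mul_of_mul_projL_eq_zero {A : Matrix m n ℍ[ℝ]} {X : Matrix o n ℍ[ℝ]}
    (h : X * projL A = 0) : X * (pinv A * A) = X := by
  rw [projL, Matrix.mul_sub, Matrix.mul_one, sub_eq_zero] at h
  exact h.symm

end Projectors

/-! ### The equations `A X - Y B = C`, `A X B = C` and `A X B + C Y D = E` -/

section Equations

variable {m n k l : Type*} [Fintype m] [Fintype n] [Fintype k] [Fintype l]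
  [DecidableEq m] [DecidableEq n] [DecidableEq k] [DecidableEq l]

theorem projR_mul_mul_projL_of_sylvester {A : Matrix m n ℍ[ℝ]} {B : Matrix k l ℍ[ℝ]}
    {C : Matrix m l ℍ[ℝ]} {X : Matrix n l ℍ[ℝ]} {Y : Matrix m k ℍ[ℝ]} (h : A * X - Y * B = C) :
    projR A * C * projL B = 0 := by
  simp only [← h, Matrix.mul_sub, Matrix.sub_mul, Matrix.mul_assoc, mul_projL_self,
    projR_mul_self_assoc, Matrix.mul_zero, Matrix.zero_mul, sub_self]

theorem sylvester_param {A : Matrix m n ℍ[ℝ]} {B : Matrix k l ℍ[ℝ]}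
    {C : Matrix m l ℍ[ℝ]} (h : projR A * C * projL B = 0)
    (U : Matrix n k ℍ[ℝ]) (V : Matrix m k ℍ[ℝ]) (W : Matrix n l ℍ[ℝ]) :
    A * (pinv A * C + U * B + projL A * W) -
      (-(projR A * C * pinv B) + A * U + V * projR B) * B = C := by
  have h1 : projR A * C * pinv B * B = projR A * C := by
    rw [Matrix.mul_assoc, mul_pinv_mul_of_mul_projL_eq_zero h]
  rw [Matrix.add_mul, Matrix.add_mul, Matrix.neg_mul, h1, Matrix.mul_assoc V, projR_mul_self,
    Matrix.mul_zero, add_zero]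
  simp only [Matrix.mul_add, Matrix.mul_assoc, mul_projL_self_assoc, add_zero, projR, Matrix.sub_mul, Matrix.one_mul]
  abel

theorem sylvester_iff {A : Matrix m n ℍ[ℝ]} {B : Matrix k l ℍ[ℝ]}
    {C : Matrix m l ℍ[ℝ]} (h : projR A * C * projL B = 0) {X : Matrix n l ℍ[ℝ]}
    {Y : Matrix m k ℍ[ℝ]} :
    A * X - Y * B = C ↔ ∃ (U : Matrix n k ℍ[ℝ]) (V : Matrix m k ℍ[ℝ]) (W : Matrix n l ℍ[ℝ]),
      X = pinv A * C + U * B + projL A * W ∧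
      Y = -(projR A * C * pinv B) + A * U + V * projR B := by
  constructor
  · rintro rfl
    -- The choice `U = A† Y`, `V = R_A Y` splits `Y` along the range of `A` and its complement.
    refine ⟨pinv A * Y, projR A * Y, X, ?_, ?_⟩ <;>
    · simp only [projR, projL, Matrix.mul_sub, Matrix.sub_mul, Matrix.mul_assoc,
        mul_pinv_mul_assoc, Matrix.one_mul, Matrix.mul_one]
      abel
  · rintro ⟨U, V, W, rfl, rfl⟩
    exact sylvester_param h U V W

/-- The same equation up to the sign of `Y`, in the parametrisation used for the block unknowns
`(W₁; T₁)` and `(W₃, T₄)`. -/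
theorem sylvester_add_iff {A : Matrix m n ℍ[ℝ]} {B : Matrix k l ℍ[ℝ]}
    {C : Matrix m l ℍ[ℝ]} (h : projR A * C * projL B = 0) {X : Matrix n l ℍ[ℝ]}
    {Y : Matrix m k ℍ[ℝ]} :
    A * X + Y * B = C ↔ ∃ (Z₆ : Matrix n l ℍ[ℝ]) (Z₇ Z₈ : Matrix m k ℍ[ℝ]),
      X = pinv A * C - pinv A * Z₇ * B + projL A * Z₆ ∧
      Y = projR A * C * pinv B + A * pinv A * Z₇ + Z₈ * projR B := by
  constructor
  · rintro rfl
    refine ⟨X, Y, projR A * Y, ?_, ?_⟩ <;>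
    · simp only [projR, projL, Matrix.mul_sub, Matrix.sub_mul, Matrix.mul_add, Matrix.add_mul,
        Matrix.mul_assoc, mul_pinv_mul_assoc, Matrix.one_mul, Matrix.mul_one]
      abel
  · rintro ⟨Z₆, Z₇, Z₈, rfl, rfl⟩
    have h1 : projR A * C * pinv B * B = projR A * C := by
      rw [Matrix.mul_assoc, mul_pinv_mul_of_mul_projL_eq_zero h]
    rw [Matrix.add_mul, Matrix.add_mul, h1, Matrix.mul_assoc Z₈, projR_mul_self,
      Matrix.mul_zero, add_zero]
    simp only [Matrix.mul_add, Matrix.mul_sub, Matrix.mul_assoc, mul_projL_self_assoc,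
      add_zero, projR, Matrix.sub_mul, Matrix.one_mul]
    abel

theorem mul_mul_eq_iff {A : Matrix m n ℍ[ℝ]} {B : Matrix k l ℍ[ℝ]}
    {C : Matrix m l ℍ[ℝ]} (h₁ : projR A * C = 0) (h₂ : C * projL B = 0) {X : Matrix n k ℍ[ℝ]} :
    A * X * B = C ↔ ∃ V W : Matrix n k ℍ[ℝ],
      X = pinv A * C * pinv B + projL A * V + W * projR B := by
  constructor
  · rintro rfl
    refine ⟨X, pinv A * A * X, ?_⟩
    simp only [projR, projL, Matrix.mul_sub, Matrix.sub_mul, Matrix.mul_assoc, Matrix.one_mul,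
      Matrix.mul_one]
    abel
  · rintro ⟨V, W, rfl⟩
    have h3 := mul_pinv_mul_of_projR_mul_eq_zero h₁
    have h4 := mul_pinv_mul_of_mul_projL_eq_zero h₂
    simp only [Matrix.mul_add, Matrix.add_mul, Matrix.mul_assoc, mul_projL_self_assoc,
      projR_mul_self, Matrix.mul_zero, add_zero, h4, h3]

end Equations

theorem projR_mul_of_mul_mul_eq {m n k l : Type*} [Fintype m] [Fintype n] [Fintype k]
    [DecidableEq m] [DecidableEq n] {A : Matrix m n ℍ[ℝ]} {B : Matrix k l ℍ[ℝ]}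
    {C : Matrix m l ℍ[ℝ]} {X : Matrix n k ℍ[ℝ]} (h : A * X * B = C) : projR A * C = 0 := by
  rw [← h, Matrix.mul_assoc, projR_mul_self_assoc]

theorem mul_projL_of_mul_mul_eq {m n k l : Type*} [Fintype n] [Fintype k] [Fintype l]
    [DecidableEq k] [DecidableEq l] {A : Matrix m n ℍ[ℝ]} {B : Matrix k l ℍ[ℝ]}
    {C : Matrix m l ℍ[ℝ]} {X : Matrix n k ℍ[ℝ]} (h : A * X * B = C) : C * projL B = 0 := by
  rw [← h, Matrix.mul_assoc, mul_projL_self, Matrix.mul_zero]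

section TwoTerm

variable {m n k l r s : Type*} [Fintype m] [Fintype n] [Fintype k] [Fintype l] [Fintype r]
  [Fintype s] [DecidableEq m] [DecidableEq n] [DecidableEq k] [DecidableEq l] [DecidableEq r]
  [DecidableEq s]
  {A : Matrix m n ℍ[ℝ]} {B : Matrix k l ℍ[ℝ]} {C : Matrix m r ℍ[ℝ]} {D : Matrix s l ℍ[ℝ]}
  {E : Matrix m l ℍ[ℝ]} {M : Matrix m r ℍ[ℝ]} {N : Matrix s l ℍ[ℝ]} {S : Matrix m r ℍ[ℝ]}

/-- The value of `C Y D` at the parametrised `Y` in the general solution of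
`A X B + C Y D = E`. -/
theorem mul_param_mul (hM : M = projR A * C) (hS : S = C * projL M)
    (h₃ : projR A * E * projL D = 0) (Z₁ Z₄ Z₅ : Matrix r s ℍ[ℝ]) :
    C * (pinv M * E * pinv D + pinv S * S * pinv C * E * pinv N + projL M * projL S * Z₄
      + projL M * Z₁ * projR N + Z₅ * projR D) * D =
    C * pinv M * E + S * pinv C * E * pinv N * D + S * Z₁ * projR N * D := by
  -- `M` is fixed by the Hermitian projector `R_A` on the left, so `M†` absorbs it on the right.
  -- This lets `h₃`, which concerns `R_A E`, act on `M† E`.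
  have e1 : pinv M * projR A = pinv M := pinv_mul_of_mul_eq (projR_conjTranspose A)
    (by rw [hM, ← Matrix.mul_assoc, projR_mul_projR])
  have e2 : projL M * pinv S = pinv S := mul_pinv_of_mul_eq (projL_conjTranspose M)
    (by rw [hS, Matrix.mul_assoc, projL_mul_projL])
  have e3 : pinv M * E * (pinv D * D) = pinv M * E := by
    rw [← e1, Matrix.mul_assoc _ (projR A), Matrix.mul_assoc,
      mul_pinv_mul_of_mul_projL_eq_zero h₃]
  have e4 : C * pinv S = S * pinv S := by
    rw [← e2, ← Matrix.mul_assoc, ← hS, e2]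
  have e5 : C * (pinv S * S) = S := by
    rw [← Matrix.mul_assoc, e4, Matrix.mul_assoc, mul_pinv_mul]
  have t1 : C * (pinv M * E * pinv D) * D = C * pinv M * E := by
    rw [Matrix.mul_assoc C, Matrix.mul_assoc _ (pinv D), e3, Matrix.mul_assoc]
  have t2 : C * (pinv S * S * pinv C * E * pinv N) * D = S * pinv C * E * pinv N * D := by
    rw [Matrix.mul_assoc (pinv S * S), Matrix.mul_assoc (pinv S * S), ← Matrix.mul_assoc C, e5]
    simp only [Matrix.mul_assoc]
  have t3 : C * (projL M * projL S * Z₄) * D = 0 := by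
    rw [← Matrix.mul_assoc C, ← Matrix.mul_assoc C, ← hS, mul_projL_self, Matrix.zero_mul,
      Matrix.zero_mul]
  have t4 : C * (projL M * Z₁ * projR N) * D = S * Z₁ * projR N * D := by
    rw [hS]; simp only [Matrix.mul_assoc]
  have t5 : C * (Z₅ * projR D) * D = 0 := by
    simp only [Matrix.mul_assoc, projR_mul_self, Matrix.mul_zero]
  simp only [Matrix.mul_add, Matrix.add_mul, t1, t2, t3, t4, t5, add_zero]

/-- For fixed `Y` the equation reads `A X B = E - C Y D`, so the task is to describe the `Y` for
which the right side is compatible with `A` and `B`. Multiplying by `R_A` or by `L_B` removes `X`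
and leaves `M Y D = R_A E` and `C Y N = E L_B`; the formula for `Y` solves both at once. -/
theorem mul_mul_add_mul_mul_iff (hM : M = projR A * C) (hN : N = D * projL B)
    (hS : S = C * projL M) (h₁ : projR M * projR A * E = 0) (h₂ : E * projL B * projL N = 0)
    (h₃ : projR A * E * projL D = 0) (h₄ : projR C * E * projL B = 0)
    {X : Matrix n k ℍ[ℝ]} {Y : Matrix r s ℍ[ℝ]} :
    A * X * B + C * Y * D = E ↔ ∃ (Z₁ : Matrix r s ℍ[ℝ]) (Z₂ Z₃ : Matrix n k ℍ[ℝ])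
      (Z₄ Z₅ : Matrix r s ℍ[ℝ]),
      X = pinv A * E * pinv B - pinv A * C * pinv M * E * pinv B
        - pinv A * S * pinv C * E * pinv N * D * pinv B
        - pinv A * S * Z₁ * projR N * D * pinv B + projL A * Z₂ + Z₃ * projR B ∧
      Y = pinv M * E * pinv D + pinv S * S * pinv C * E * pinv N + projL M * projL S * Z₄
        + projL M * Z₁ * projR N + Z₅ * projR D := by
  have e1 : pinv M * projR A = pinv M := pinv_mul_of_mul_eq (projR_conjTranspose A)
    (by rw [hM, ← Matrix.mul_assoc, projR_mul_projR])
  have e2 : projL B * pinv N = pinv N := mul_pinv_of_mul_eq (projL_conjTranspose B)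
    (by rw [hN, Matrix.mul_assoc, projL_mul_projL])
  have e3 : projL M * pinv S = pinv S := mul_pinv_of_mul_eq (projL_conjTranspose M)
    (by rw [hS, Matrix.mul_assoc, projL_mul_projL])
  have hMC : M * (pinv C * C) = M := by rw [hM, Matrix.mul_assoc, mul_pinv_mul]
  -- Once `C Y D` is evaluated, the long formula for `X` is the general solution of `A X B = E - C Y
  -- D`.
  have key : ∀ (Z₁ : Matrix r s ℍ[ℝ]) (Z₂ Z₃ : Matrix n k ℍ[ℝ]) (Z₄ Z₅ : Matrix r s ℍ[ℝ]), (X = pinv A * E * pinv B - pinv A * C * pinv M * E * pinv B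
        - pinv A * S * pinv C * E * pinv N * D * pinv B
        - pinv A * S * Z₁ * projR N * D * pinv B + projL A * Z₂ + Z₃ * projR B ∧
      Y = pinv M * E * pinv D + pinv S * S * pinv C * E * pinv N + projL M * projL S * Z₄
        + projL M * Z₁ * projR N + Z₅ * projR D) ↔
      (X = pinv A * (E - C * Y * D) * pinv B + projL A * Z₂ + Z₃ * projR B ∧
      Y = pinv M * E * pinv D + pinv S * S * pinv C * E * pinv N + projL M * projL S * Z₄
        + projL M * Z₁ * projR N + Z₅ * projR D) := by
    intro Z₁ Z₂ Z₃ Z₄ Z₅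
    refine and_congr_left fun hY => ?_
    rw [hY, mul_param_mul hM hS h₃]
    have : pinv A * E * pinv B - pinv A * C * pinv M * E * pinv B
        - pinv A * S * pinv C * E * pinv N * D * pinv B
        - pinv A * S * Z₁ * projR N * D * pinv B = pinv A * (E - (C * pinv M * E +
          S * pinv C * E * pinv N * D + S * Z₁ * projR N * D)) * pinv B := by
      simp only [Matrix.mul_sub, Matrix.sub_mul, Matrix.mul_add, Matrix.add_mul, Matrix.mul_assoc]
      abel
    rw [this]
  simp only [key]
  constructor
  · intro h
    have hX : A * X * B = E - C * Y * D := by rw [← h]; abel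
    obtain ⟨Z₂, Z₃, hX'⟩ := (mul_mul_eq_iff (projR_mul_of_mul_mul_eq hX)
      (mul_projL_of_mul_mul_eq hX)).1 hX
    -- With these parameters the terms for `Y` telescope: `M† M Y D D†` and `L_M L_S Y D D† = (L_M -
    -- S† S) Y D D†` combine, the `S† S` parts cancel, and `Y R_D` supplies the rest.
    refine ⟨pinv S * S * Y * (D * pinv D), Z₂, Z₃, Y * (D * pinv D), Y, hX', ?_⟩
    have f1 : pinv M * E = pinv M * M * Y * D := by
      have : projR A * E = M * Y * D := by
        rw [← h, hM]
        simp only [Matrix.mul_add, Matrix.mul_assoc, projR_mul_self_assoc, zero_add]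
      rw [← e1, Matrix.mul_assoc, this, e1]
      simp only [Matrix.mul_assoc]
    have f2 : E * pinv N = C * Y * (N * pinv N) := by
      have : E * projL B = C * Y * N := by
        rw [← h, hN]
        simp only [Matrix.add_mul, Matrix.mul_assoc, mul_projL_self, Matrix.mul_zero, zero_add]
      rw [← e2, ← Matrix.mul_assoc, this, e2, Matrix.mul_assoc]
    have f3 : S * (pinv C * C) = S := by
      rw [hS, projL, Matrix.mul_sub, Matrix.mul_one, Matrix.sub_mul, mul_pinv_mul,
        Matrix.mul_assoc C, Matrix.mul_assoc _ M, hMC]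
    have f4 : projL M * (pinv S * S) = pinv S * S := by rw [← Matrix.mul_assoc, e3]
    have f6 : D * pinv D * N = N := by
      rw [hN, ← Matrix.mul_assoc, (isMoorePenrose_pinv D).mul_mul_self]
    have f8 : D * pinv D * (N * pinv N) = N * pinv N := by rw [← Matrix.mul_assoc, f6]
    have t2 : pinv S * S * pinv C * E * pinv N = pinv S * S * Y * (N * pinv N) := by
      rw [Matrix.mul_assoc _ E, f2, Matrix.mul_assoc _ (pinv C), ← Matrix.mul_assoc (pinv C),
        ← Matrix.mul_assoc (pinv C), Matrix.mul_assoc (pinv S), ← Matrix.mul_assoc S,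
        ← Matrix.mul_assoc S, f3]
      simp only [Matrix.mul_assoc]
    have t3 : projL M * projL S = projL M - pinv S * S := by
      rw [projL.eq_def S, Matrix.mul_sub, Matrix.mul_one, f4]
    have t4 : projL M * (pinv S * S * Y * (D * pinv D)) * projR N =
        pinv S * S * Y * (D * pinv D) - pinv S * S * Y * (N * pinv N) := by
      rw [Matrix.mul_assoc (pinv S * S), ← Matrix.mul_assoc (projL M), f4, projR, Matrix.mul_sub,
        Matrix.mul_one, Matrix.mul_assoc _ _ (N * pinv N), Matrix.mul_assoc Y, f8,
        Matrix.mul_assoc (pinv S * S)]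
    rw [f1, t2, t3, t4]
    simp only [projL, projR, Matrix.mul_sub, Matrix.sub_mul, Matrix.mul_assoc, Matrix.one_mul,
      Matrix.mul_one]
    abel
  · rintro ⟨Z₁, Z₂, Z₃, Z₄, Z₅, hX, hY⟩
    have hCY : C * Y * D = C * pinv M * E + S * pinv C * E * pinv N * D +
        S * Z₁ * projR N * D := by rw [hY, mul_param_mul hM hS h₃]
    have hMS : projR A * S = 0 := by rw [hS, ← Matrix.mul_assoc, ← hM, mul_projL_self]
    have a1 : projR A * (E - C * Y * D) = 0 := by
      have g : M * (pinv M * E) = projR A * E := by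
        rw [← e1, Matrix.mul_assoc _ _ E]
        exact mul_pinv_mul_of_projR_mul_eq_zero (by rw [← Matrix.mul_assoc, h₁])
      rw [hCY, Matrix.mul_sub, Matrix.mul_add, Matrix.mul_add]
      simp only [← Matrix.mul_assoc, hMS, Matrix.zero_mul, add_zero]
      rw [← hM, Matrix.mul_assoc, g, sub_self]
    -- By `h₂`, `E N† N = E L_B`; by `h₄`, `C C† E L_B = E L_B`. Hence the term with `S C†` becomes
    -- `E L_B - C M† E L_B`, while the `Z₁` term dies because `R_N N = 0`.
    have a2 : (E - C * Y * D) * projL B = 0 := by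
      have g1 : E * pinv N * N = E * projL B := by
        rw [← e2, Matrix.mul_assoc, Matrix.mul_assoc, ← Matrix.mul_assoc E,
          mul_pinv_mul_of_mul_projL_eq_zero h₂]
      have g2 : C * (pinv C * (E * projL B)) = E * projL B :=
        mul_pinv_mul_of_projR_mul_eq_zero (by rw [← Matrix.mul_assoc, h₄])
      have g3 : M * (pinv C * (E * projL B)) = projR A * (E * projL B) := by
        rw [hM, Matrix.mul_assoc, g2]
      have g4 : S * pinv C * E * pinv N * D * projL B = E * projL B - C * pinv M * E * projL B := by
        rw [Matrix.mul_assoc _ D, ← hN, Matrix.mul_assoc _ _ N, Matrix.mul_assoc _ E,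
          ← Matrix.mul_assoc E, g1, hS, projL.eq_def M, Matrix.mul_sub, Matrix.mul_one,
          Matrix.sub_mul, Matrix.sub_mul, Matrix.mul_assoc, g2]
        congr 1
        simp only [Matrix.mul_assoc]
        rw [g3, ← Matrix.mul_assoc (pinv M), e1]
      rw [Matrix.sub_mul, hCY, Matrix.add_mul, Matrix.add_mul, g4, Matrix.mul_assoc _ D, ← hN,
        Matrix.mul_assoc _ _ N, projR_mul_self, Matrix.mul_zero]
      abel
    have := (mul_mul_eq_iff a1 a2).2 ⟨Z₂, Z₃, hX⟩
    rw [this]; abel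

end TwoTerm

/-! ### Rank of a bordered matrix -/

section Rank

variable {m n k l : Type*} [Fintype n] [Fintype l]

/-- The right linear map `v ↦ A v` on column vectors. -/
def mulVecRight (A : Matrix m n ℍ[ℝ]) : (n → ℍ[ℝ]) →ₗ[ℍ[ℝ]ᵐᵒᵖ] (m → ℍ[ℝ]) where
  toFun v := A *ᵥ v
  map_add' := Matrix.mulVec_add A
  map_smul' c v := Matrix.mulVec_smul A c v

theorem mulVecRight_apply (A : Matrix m n ℍ[ℝ]) (v : n → ℍ[ℝ]) : mulVecRight A v = A *ᵥ v := rfl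

theorem span_range_col (A : Matrix m n ℍ[ℝ]) :
    Submodule.span ℍ[ℝ]ᵐᵒᵖ (Set.range A.col) = LinearMap.range (mulVecRight A) := by
  classical
  apply le_antisymm
  · rw [Submodule.span_le]
    rintro _ ⟨j, rfl⟩
    exact ⟨Pi.single j 1, by simp [mulVecRight_apply]⟩
  · rintro _ ⟨v, rfl⟩
    rw [mulVecRight_apply, Matrix.mulVec_eq_sum]
    exact Submodule.sum_mem _ fun j _ =>
      Submodule.smul_mem _ _ (Submodule.subset_span ⟨j, rfl⟩)

theorem rank_eq_finrank_range (A : Matrix m n ℍ[ℝ]) :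
    rank A = Module.finrank ℍ[ℝ]ᵐᵒᵖ (LinearMap.range (mulVecRight A)) := by
  rw [rank, span_range_col]

instance finite_mulOpposite_quaternion : Module.Finite ℍ[ℝ]ᵐᵒᵖ ℍ[ℝ] :=
  Module.Finite.of_surjective (LinearMap.toSpanSingleton ℍ[ℝ]ᵐᵒᵖ ℍ[ℝ] 1)
    fun a => ⟨MulOpposite.op a, by simp⟩

/-- The rank of `(C A; B 0)` is `r(B)` plus the dimension of the image of `(C v + A w)` over the
kernel of `B`. -/
theorem rank_fromBlocks_zero (A : Matrix m n ℍ[ℝ]) (B : Matrix k l ℍ[ℝ]) (C : Matrix m l ℍ[ℝ]) :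
    rank (Matrix.fromBlocks C A B 0) = rank B + Module.finrank ℍ[ℝ]ᵐᵒᵖ
      ↥(LinearMap.range (mulVecRight A) ⊔
        (LinearMap.ker (mulVecRight B)).map (mulVecRight C)) := by
  set T := mulVecRight (Matrix.fromBlocks C A B 0)
  let π₂ : (m ⊕ k → ℍ[ℝ]) →ₗ[ℍ[ℝ]ᵐᵒᵖ] (k → ℍ[ℝ]) := LinearMap.funLeft _ _ Sum.inr
  let π₁ : (m ⊕ k → ℍ[ℝ]) →ₗ[ℍ[ℝ]ᵐᵒᵖ] (m → ℍ[ℝ]) := LinearMap.funLeft _ _ Sum.inl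
  have hT₁ : ∀ v, π₁ (T v) = C *ᵥ (v ∘ Sum.inl) + A *ᵥ (v ∘ Sum.inr) := by
    intro v; ext1 i
    simp [π₁, T, mulVecRight_apply, Matrix.fromBlocks_mulVec, LinearMap.funLeft_apply]
  have hT₂ : ∀ v, π₂ (T v) = B *ᵥ (v ∘ Sum.inl) := by
    intro v; ext1 i
    simp [π₂, T, mulVecRight_apply, Matrix.fromBlocks_mulVec, LinearMap.funLeft_apply]
  -- Rank-nullity for the projection of the column space onto the lower block: its image is the
  -- range of `B`, and its kernel, read in the upper block, is the range of `A` plus `C (ker B)`.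
  have h := (π₂.domRestrict (LinearMap.range T)).finrank_range_add_finrank_ker
  have hr : LinearMap.range (π₂.domRestrict (LinearMap.range T)) =
      LinearMap.range (mulVecRight B) := by
    ext w
    simp only [LinearMap.mem_range, Subtype.exists, LinearMap.domRestrict_apply]
    constructor
    · rintro ⟨_, ⟨v, rfl⟩, rfl⟩
      exact ⟨v ∘ Sum.inl, (hT₂ v).symm⟩
    · rintro ⟨v, rfl⟩
      exact ⟨_, ⟨Sum.elim v 0, rfl⟩, by rw [hT₂]; rfl⟩
  have hk : Module.finrank ℍ[ℝ]ᵐᵒᵖ (LinearMap.ker (π₂.domRestrict (LinearMap.range T))) =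
      Module.finrank ℍ[ℝ]ᵐᵒᵖ ↥(LinearMap.range (mulVecRight A) ⊔
        (LinearMap.ker (mulVecRight B)).map (mulVecRight C)) := by
    let f := π₁ ∘ₗ (LinearMap.range T).subtype ∘ₗ
      (LinearMap.ker (π₂.domRestrict (LinearMap.range T))).subtype
    have hf : Function.Injective f := by
      rintro ⟨⟨x, hx⟩, hx'⟩ ⟨⟨y, hy⟩, hy'⟩ hxy
      have hxy : π₁ x = π₁ y := hxy
      have hx' : π₂ x = 0 := hx'
      have hy' : π₂ y = 0 := hy'
      ext1; ext1
      funext i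
      rcases i with i | i
      · exact congrFun hxy i
      · exact (congrFun hx' i).trans (congrFun hy' i).symm
    rw [← LinearMap.finrank_range_of_inj hf]
    refine congrArg (fun P : Submodule ℍ[ℝ]ᵐᵒᵖ (m → ℍ[ℝ]) => Module.finrank ℍ[ℝ]ᵐᵒᵖ P) ?_
    ext w
    rw [Submodule.mem_sup]
    constructor
    · rintro ⟨⟨⟨_, v, rfl⟩, hv⟩, rfl⟩
      have hv : π₂ (T v) = 0 := hv
      refine ⟨A *ᵥ (v ∘ Sum.inr), ⟨_, rfl⟩, C *ᵥ (v ∘ Sum.inl), ⟨_, ?_, rfl⟩, ?_⟩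
      · exact (hT₂ v).symm.trans hv
      · rw [add_comm]; exact (hT₁ v).symm
    · rintro ⟨_, ⟨a, rfl⟩, _, ⟨b, hb, rfl⟩, rfl⟩
      refine ⟨⟨⟨_, Sum.elim b a, rfl⟩, ?_⟩, ?_⟩
      · exact (hT₂ _).trans hb
      · rw [add_comm]; exact (hT₁ _)
  rw [rank_eq_finrank_range B, rank_eq_finrank_range, ← hk, ← hr]
  exact h.symm

variable [Fintype m] [Fintype k] [DecidableEq m] [DecidableEq n] [DecidableEq k] [DecidableEq l]

/-- `r (C A; B 0) = r(A) + r(B)` exactly when `R_A C L_B = 0`. -/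
theorem rank_fromBlocks_zero_eq_iff (A : Matrix m n ℍ[ℝ]) (B : Matrix k l ℍ[ℝ])
    (C : Matrix m l ℍ[ℝ]) :
    rank (Matrix.fromBlocks C A B 0) = rank A + rank B ↔ projR A * C * projL B = 0 := by
  rw [rank_fromBlocks_zero, add_comm, Nat.add_right_cancel_iff, rank_eq_finrank_range]
  constructor
  · intro h
    -- Equality of dimensions forces `C (ker B)` into the range of `A`; the columns of `L_B` lie in
    -- `ker B`.
    have h1 := Submodule.eq_of_le_of_finrank_eq le_sup_left h.symm
    apply Matrix.ext_of_mulVec_single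
    intro j
    have hmem : C *ᵥ (projL B *ᵥ Pi.single j 1) ∈ LinearMap.range (mulVecRight A) := by
      rw [h1]
      refine Submodule.mem_sup_right ⟨projL B *ᵥ Pi.single j 1, ?_, rfl⟩
      change B *ᵥ (projL B *ᵥ Pi.single j 1) = 0
      rw [Matrix.mulVec_mulVec, mul_projL_self, Matrix.zero_mulVec]
    obtain ⟨w, hw⟩ := hmem
    rw [← Matrix.mulVec_mulVec, ← Matrix.mulVec_mulVec, ← hw, mulVecRight_apply,
      Matrix.mulVec_mulVec, projR_mul_self, Matrix.zero_mulVec, Matrix.zero_mulVec]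
  · intro h
    rw [sup_eq_left.2]
    rintro _ ⟨v, hv, rfl⟩
    have hv : B *ᵥ v = 0 := hv
    have hv' : projL B *ᵥ v = v := by
      rw [projL, Matrix.sub_mulVec, Matrix.one_mulVec, ← Matrix.mulVec_mulVec, hv,
        Matrix.mulVec_zero, sub_zero]
    have h2 : projR A *ᵥ (C *ᵥ v) = 0 := by
      rw [← hv', Matrix.mulVec_mulVec, Matrix.mulVec_mulVec, h,
        Matrix.zero_mulVec]
    rw [projR, Matrix.sub_mulVec, Matrix.one_mulVec, ← Matrix.mulVec_mulVec, sub_eq_zero] at h2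
    exact ⟨_, h2.symm⟩

theorem rank_fromBlocks_zero_of_sylvester {A : Matrix m n ℍ[ℝ]} {B : Matrix k l ℍ[ℝ]}
    {C : Matrix m l ℍ[ℝ]} {X : Matrix n l ℍ[ℝ]} {Y : Matrix m k ℍ[ℝ]} (h : A * X - Y * B = C) :
    rank (Matrix.fromBlocks C A B 0) = rank A + rank B :=
  (rank_fromBlocks_zero_eq_iff A B C).2 (projR_mul_mul_projL_of_sylvester h)

/-- The hypotheses give `u = u R_A` and `v = L_B v`, so the product contains `R_A C L_B`. The rank
equalities are mostly used in this form. -/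
theorem mul_mul_eq_zero_of_rank {A : Matrix m n ℍ[ℝ]} {B : Matrix k l ℍ[ℝ]}
    {C : Matrix m l ℍ[ℝ]} (h : rank (Matrix.fromBlocks C A B 0) = rank A + rank B)
    {r s : Type*} {u : Matrix r m ℍ[ℝ]} {v : Matrix l s ℍ[ℝ]} (hu : u * A = 0) (hv : B * v = 0) :
    u * C * v = 0 := by
  have h1 := (rank_fromBlocks_zero_eq_iff A B C).1 h
  have hu' : u * projR A = u := by
    rw [projR, Matrix.mul_sub, ← Matrix.mul_assoc, hu, Matrix.zero_mul, Matrix.mul_one, sub_zero]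
  have hv' : projL B * v = v := by
    rw [projL, Matrix.sub_mul, Matrix.mul_assoc, hv, Matrix.mul_zero, Matrix.one_mul, sub_zero]
  rw [← hu', ← hv', ← Matrix.mul_assoc, Matrix.mul_assoc u, Matrix.mul_assoc u, h1,
    Matrix.mul_zero, Matrix.zero_mul]

end Rank

namespace SylvesterSystem

open Matrix

variable {m₁ m₃ m₄ n₁ p k₁ k₂ q s t : ℕ} {G : SylvesterSystem m₁ m₃ m₄ n₁ p k₁ k₂ q s t}

/-! ### Consistency implies the rank conditions -/

theorem IsConsistent.rankConditions (h : G.IsConsistent) : G.RankConditions := by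
  obtain ⟨X₁, X₂, X₃, X₄, X₅, h₁, h₂, h₃, h₄⟩ := h
  -- Adding `A₄` times the third equation to the fourth times `B₃` eliminates `X₄`.
  have h₃₄ : G.A₄ * G.A₃ * X₃ - X₅ * (G.B₄ * G.B₃) = G.A₄ * G.C₃ + G.C₄ * G.B₃ := by
    rw [← h₃, ← h₄]
    simp only [Matrix.mul_sub, Matrix.sub_mul, Matrix.mul_assoc]
    abel
  have e₁ := sub_eq_iff_eq_add.1 h₁
  have e₂ := sub_eq_iff_eq_add.1 h₂
  have e₃ := sub_eq_iff_eq_add.1 h₃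
  have e₃₄ := sub_eq_iff_eq_add.1 h₃₄
  refine ⟨rank_fromBlocks_zero_of_sylvester h₁, rank_fromBlocks_zero_of_sylvester h₂,
    rank_fromBlocks_zero_of_sylvester h₃, rank_fromBlocks_zero_of_sylvester h₄,
    rank_fromBlocks_zero_of_sylvester (X := fromBlocks X₁ 0 0 X₃) (Y := X₂) ?_,
    rank_fromBlocks_zero_of_sylvester h₃₄,
    rank_fromBlocks_zero_of_sylvester (X := fromBlocks X₁ 0 0 X₃) (Y := fromBlocks X₂ 0 0 X₅) ?_,
    rank_fromBlocks_zero_of_sylvester (X := X₃) (Y := fromBlocks X₂ 0 0 X₄) ?_,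
    rank_fromBlocks_zero_of_sylvester (X := fromBlocks X₁ 0 0 X₃) (Y := fromBlocks X₂ 0 0 X₄) ?_,
    rank_fromBlocks_zero_of_sylvester (X := X₃) (Y := fromBlocks X₂ 0 0 X₅) ?_⟩
  · rw [sub_eq_iff_eq_add, fromCols_mul_fromBlocks, mul_fromCols]
    simp only [Matrix.mul_zero, add_zero, zero_add, e₁, e₂]
    ext i (j | j) <;> simp
  · rw [sub_eq_iff_eq_add, fromBlocks_multiply, fromBlocks_multiply, fromBlocks_add]
    simp only [Matrix.mul_zero, Matrix.zero_mul, add_zero, zero_add, e₁, e₂, e₃₄]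
  · rw [sub_eq_iff_eq_add, fromRows_mul, fromBlocks_mul_fromRows]
    simp only [Matrix.zero_mul, add_zero, zero_add, e₂, e₃]
    ext (i | i) j <;> simp
  · rw [sub_eq_iff_eq_add, fromBlocks_multiply, fromBlocks_multiply, fromBlocks_add]
    simp only [Matrix.mul_zero, Matrix.zero_mul, add_zero, zero_add, e₁, e₂, e₃]
  · rw [sub_eq_iff_eq_add, fromRows_mul, fromBlocks_mul_fromRows]
    simp only [Matrix.zero_mul, add_zero, zero_add, e₂, e₃₄]
    ext (i | i) j <;> simp

/-! ### The rank conditions imply the projector conditions -/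

/-! ### Values that each half of the system forces on `x X₃ v`. -/

section Functionals

variable {a b : Type*} {x : Matrix a (Fin p) ℍ[ℝ]} {v : Matrix (Fin k₂) b ℍ[ℝ]}

variable (G) in
/-- The part of `E₁` coming from the first two equations. -/
noncomputable def leftPart : Matrix (Fin p) (Fin k₂) ℍ[ℝ] :=
  pinv G.A₂ * G.C₂ + pinv G.B₁₁ * G.D₁₁ * pinv G.C₁₁ * G.B₂

variable (G) in
/-- The part of `E₁` coming from the last two equations. -/
noncomputable def rightPart : Matrix (Fin p) (Fin k₂) ℍ[ℝ] :=
  pinv G.A₃ * G.C₃ + pinv (G.A₄ * G.A₃) * (G.C₄ * G.B₃ + G.A₄ * projR G.A₃ * G.C₃)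

theorem E₁_eq : G.E₁ = G.rightPart - G.leftPart := by
  rw [E₁, rightPart, leftPart]; abel

theorem mul_leftPart_mul_of_B₂ (hx : x * projL G.A₂ = 0) (hv : G.B₂ * v = 0) :
    ∃ z : Matrix a (Fin m₁) ℍ[ℝ], z * G.A₂ = x ∧ x * G.leftPart * v = z * G.C₂ * v := by
  refine ⟨x * pinv G.A₂, ?_, ?_⟩
  · rw [Matrix.mul_assoc, mul_pinv_mul_of_mul_projL_eq_zero hx]
  · simp only [leftPart, Matrix.mul_add, Matrix.add_mul, Matrix.mul_assoc, hv, Matrix.mul_zero,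
      add_zero]

/-- For a solution, `z A₁ = 0`, `z A₂ = x` and `B₁ w = B₂ v` give `x X₃ v = z C₂ v + z X₂ B₁ w = z
C₂ v - z C₁ w`. `leftPart` takes this same value without a solution being assumed. -/
theorem mul_leftPart_mul_of_B₁₁ (h : projR G.A₂ * G.C₂ * projL G.B₂ = 0)
    (hx : x * projL G.B₁₁ = 0) (hv : projR G.C₁₁ * G.B₂ * v = 0) :
    ∃ (z : Matrix a (Fin m₁) ℍ[ℝ]) (w : Matrix (Fin k₁) b ℍ[ℝ]), z * G.A₁ = 0 ∧ z * G.A₂ = x ∧ G.B₁ * w = G.B₂ * v ∧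
      x * G.leftPart * v = z * G.C₂ * v - z * G.C₁ * w := by
  have hz : x * pinv G.B₁₁ * projR G.A₁ * G.A₂ = x := by
    rw [Matrix.mul_assoc, ← B₁₁, Matrix.mul_assoc, mul_pinv_mul_of_mul_projL_eq_zero hx]
  have hw : G.B₁ * (projL G.A₁₁ * (pinv G.C₁₁ * (G.B₂ * v))) = G.B₂ * v := by
    rw [← Matrix.mul_assoc G.B₁, ← C₁₁]
    exact mul_pinv_mul_of_projR_mul_eq_zero (by rw [← Matrix.mul_assoc, hv])
  have h' : projR G.A₂ * G.C₂ * pinv G.B₂ * G.B₂ = projR G.A₂ * G.C₂ := by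
    rw [Matrix.mul_assoc, mul_pinv_mul_of_mul_projL_eq_zero h]
  refine ⟨x * pinv G.B₁₁ * projR G.A₁, projL G.A₁₁ * (pinv G.C₁₁ * (G.B₂ * v)), ?_, hz, hw, ?_⟩
  · rw [Matrix.mul_assoc, projR_mul_self, Matrix.mul_zero]
  · set z := x * pinv G.B₁₁ * projR G.A₁
    set w := projL G.A₁₁ * (pinv G.C₁₁ * (G.B₂ * v))
    have h1 : x * (pinv G.B₁₁ * G.D₁₁ * pinv G.C₁₁ * G.B₂) * v =
        z * (projR G.A₂ * G.C₂) * v - z * G.C₁ * w := by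
      have h2 : x * (pinv G.B₁₁ * G.D₁₁ * pinv G.C₁₁ * G.B₂) * v =
          z * (projR G.A₂ * G.C₂ * pinv G.B₂ * (G.B₁ * w)) - z * G.C₁ * w := by
        simp only [D₁₁, z, w, Matrix.mul_sub, Matrix.sub_mul, Matrix.mul_assoc]
      rw [h2, hw, ← Matrix.mul_assoc _ G.B₂, h', Matrix.mul_assoc z _ v]
    have h3 : x * (pinv G.A₂ * G.C₂) * v = z * (G.A₂ * pinv G.A₂ * G.C₂) * v := by
      rw [← hz]; simp only [Matrix.mul_assoc]
    rw [leftPart, Matrix.mul_add, Matrix.add_mul, h1, h3, projR]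
    simp only [Matrix.mul_sub, Matrix.sub_mul, Matrix.one_mul]
    abel

theorem mul_rightPart_mul_of_B₃ (h : projR G.A₃ * G.C₃ * projL G.B₃ = 0)
    (hx : x * projL G.A₃ = 0) (hv : G.B₃ * v = 0) :
    ∃ z : Matrix a (Fin m₃) ℍ[ℝ], z * G.A₃ = x ∧ x * G.rightPart * v = z * G.C₃ * v := by
  refine ⟨x * pinv G.A₃, ?_, ?_⟩
  · rw [Matrix.mul_assoc, mul_pinv_mul_of_mul_projL_eq_zero hx]
  -- Solvability of the third equation gives `R_{A₃} C₃ = R_{A₃} C₃ B₃† B₃`, which kills `v`.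
  · have h1 : projR G.A₃ * (G.C₃ * v) = 0 := by
      rw [← Matrix.mul_assoc, ← mul_pinv_mul_of_mul_projL_eq_zero h, Matrix.mul_assoc,
        Matrix.mul_assoc (pinv _), hv, Matrix.mul_zero, Matrix.mul_zero]
    simp only [rightPart, Matrix.mul_add, Matrix.add_mul, Matrix.mul_assoc, hv, h1,
      Matrix.mul_zero, add_zero]

theorem mul_rightPart_mul_of_A₄_mul_A₃ (hx : x * projL (G.A₄ * G.A₃) = 0) :
    ∃ z : Matrix a (Fin m₄) ℍ[ℝ], z * (G.A₄ * G.A₃) = x ∧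
      x * G.rightPart * v = z * (G.A₄ * G.C₃ + G.C₄ * G.B₃) * v := by
  have hz : x * pinv (G.A₄ * G.A₃) * (G.A₄ * G.A₃) = x := by
    rw [Matrix.mul_assoc, mul_pinv_mul_of_mul_projL_eq_zero hx]
  refine ⟨x * pinv (G.A₄ * G.A₃), hz, ?_⟩
  set z := x * pinv (G.A₄ * G.A₃)
  have h1 : x * (pinv G.A₃ * G.C₃) = z * (G.A₄ * (G.A₃ * pinv G.A₃) * G.C₃) := by
    rw [← hz]; simp only [Matrix.mul_assoc]
  rw [rightPart, Matrix.mul_add, h1, ← Matrix.mul_assoc x, ← Matrix.mul_add, projR,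
    Matrix.mul_sub, Matrix.mul_one, Matrix.sub_mul]
  congr 2
  abel

theorem mul_projL_of_mul_A₃₃ (hx : x * G.A₃₃ = 0) :
    x * projL G.A₂ = 0 ∧ x * projL G.A₃ = 0 := by
  rw [A₃₃, mul_fromCols, ← fromCols_zero, fromCols_ext_iff, Matrix.mul_neg, neg_eq_zero] at hx
  exact hx

theorem mul_of_B₃₃_mul (hv : G.B₃₃ * v = 0) :
    projR G.C₁₁ * G.B₂ * v = 0 ∧ G.B₄ * G.B₃ * v = 0 := by
  rw [B₃₃, fromRows_mul, ← fromRows_zero, fromRows_ext_iff, Matrix.neg_mul, neg_eq_zero] at hv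
  exact hv

end Functionals

/-- In the last four conditions `E` is a compression of `rightPart - leftPart`. The outer factors
`x, v` make each part a known expression in the `C_i`, and the difference is, up to sign, a product
`u C v` annihilated by a block rank equality. Which of the four equalities applies depends on
whether the left half uses one or two equations, and likewise the right half. -/
theorem RankConditions.projectorConditions (h : G.RankConditions) : G.ProjectorConditions := by
  obtain ⟨r₁, r₂, r₃, r₄, r₁₂, r₃₄, r₁₂₃₄, r₂₃, r₁₂₃, r₂₃₄⟩ := h
  have c₂ := (rank_fromBlocks_zero_eq_iff _ _ _).1 r₂
  have c₃ := (rank_fromBlocks_zero_eq_iff _ _ _).1 r₃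
  have k₂' : projR G.A₂ * G.C₂ * pinv G.B₂ * G.B₂ = projR G.A₂ * G.C₂ := by
    rw [Matrix.mul_assoc, mul_pinv_mul_of_mul_projL_eq_zero c₂]
  have k₃' : projR G.A₃ * G.C₃ * pinv G.B₃ * G.B₃ = projR G.A₃ * G.C₃ := by
    rw [Matrix.mul_assoc, mul_pinv_mul_of_mul_projL_eq_zero c₃]
  have hA₃₃ := projR_mul_self G.A₃₃
  have hB₃₃ := mul_projL_self G.B₃₃
  refine ⟨⟨c₂, ?_, ?_⟩, ⟨c₃, ?_, ?_⟩, ?_, ?_, ?_, ?_⟩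
  · have hv : G.B₁ * (projL G.A₁₁ * projL G.C₁₁) = 0 := by
      rw [← Matrix.mul_assoc, ← C₁₁, mul_projL_self]
    have := mul_mul_eq_zero_of_rank r₁ (projR_mul_self G.A₁) hv
    simp only [D₁₁, Matrix.mul_assoc, Matrix.mul_sub, Matrix.sub_mul, hv, Matrix.mul_zero,
      zero_sub, neg_eq_zero] at this ⊢
    exact this
  · have hu₁ : projR G.B₁₁ * projR G.A₁ * G.A₁ = 0 := by
      rw [Matrix.mul_assoc, projR_mul_self, Matrix.mul_zero]
    have hu₂ : projR G.B₁₁ * projR G.A₁ * G.A₂ = 0 := by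
      rw [Matrix.mul_assoc, ← B₁₁, projR_mul_self]
    -- `A₁₁ = R_{B₂} B₁` is killed by `L_{A₁₁}`, so `B₁ L_{A₁₁}` factors through `B₂`; this gives a
    -- column annihilated by `(B₁, B₂)`.
    have hv : G.B₂ * (pinv G.B₂ * (G.B₁ * projL G.A₁₁)) = G.B₁ * projL G.A₁₁ :=
      mul_pinv_mul_of_projR_mul_eq_zero (by rw [← Matrix.mul_assoc, ← A₁₁, mul_projL_self])
    have := mul_mul_eq_zero_of_rank r₁₂ (u := projR G.B₁₁ * projR G.A₁)
      (v := fromRows (-projL G.A₁₁) (pinv G.B₂ * (G.B₁ * projL G.A₁₁)))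
      (by rw [mul_fromCols, hu₁, hu₂, fromCols_zero])
      (by rw [fromCols_mul_fromRows, hv, Matrix.mul_neg, neg_add_cancel])
    rw [mul_fromCols, fromCols_mul_fromRows] at this
    have h2 : projR G.B₁₁ * (projR G.A₁ * (projR G.A₂ * G.C₂ * pinv G.B₂ * G.B₁)) * projL G.A₁₁ =
        projR G.B₁₁ * projR G.A₁ * G.C₂ * (pinv G.B₂ * (G.B₁ * projL G.A₁₁)) := by
      rw [projR.eq_def G.A₂, ← Matrix.mul_assoc (projR G.B₁₁)]
      simp only [Matrix.sub_mul, Matrix.mul_sub, Matrix.one_mul, ← Matrix.mul_assoc, hu₂,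
        Matrix.zero_mul, sub_zero]
    rw [D₁₁, ← Matrix.mul_assoc, Matrix.mul_sub, Matrix.mul_sub, Matrix.sub_mul, h2, ← this]
    simp only [Matrix.mul_neg, Matrix.mul_assoc]
    abel
  · have hu : projR G.A₂₂ * projR (G.A₄ * G.A₃) * G.A₄ = 0 := by
      rw [Matrix.mul_assoc, ← A₂₂, projR_mul_self]
    have := mul_mul_eq_zero_of_rank r₄ hu (mul_projL_self _)
    rw [C₂₂, ← this, ← Matrix.mul_assoc, ← Matrix.mul_assoc, Matrix.mul_add]
    simp only [← Matrix.mul_assoc, hu, Matrix.zero_mul, zero_add]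
  -- `R_{B₃}` kills `L_{B₄} L_{B₂₂}` by the definition of `B₂₂`, so this product factors through
  -- `B₃`, and the factor is annihilated by `B₄ B₃`.
  · have hB : projL G.B₄ * projL G.B₂₂ = G.B₃ * (pinv G.B₃ * (projL G.B₄ * projL G.B₂₂)) :=
      (mul_pinv_mul_of_projR_mul_eq_zero
        (by rw [← Matrix.mul_assoc, ← B₂₂, mul_projL_self])).symm
    have := mul_mul_eq_zero_of_rank r₃₄ (projR_mul_self _)
      (v := pinv G.B₃ * (projL G.B₄ * projL G.B₂₂))
      (by rw [Matrix.mul_assoc, ← hB, mul_projL_self_assoc])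
    rw [C₂₂, Matrix.mul_assoc, hB, ← this, ← Matrix.mul_assoc _ G.B₃]
    congr 1
    have h2 : G.A₄ * projR G.A₃ * G.C₃ * pinv G.B₃ * G.B₃ = G.A₄ * (projR G.A₃ * G.C₃) := by
      rw [← k₃']; simp only [Matrix.mul_assoc]
    rw [Matrix.mul_assoc, Matrix.add_mul, h2, Matrix.mul_add, Matrix.mul_add, projR.eq_def G.A₃,
      Matrix.sub_mul, Matrix.one_mul, Matrix.mul_sub, Matrix.mul_sub, Matrix.mul_assoc G.A₃,
      ← Matrix.mul_assoc G.A₄ G.A₃, projR_mul_self_assoc, sub_zero]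
  · set x := projR G.M * projR G.A * projR G.A₃₃ with hx
    have hxA : projR G.M * projR G.A * G.A = 0 := by
      rw [Matrix.mul_assoc, projR_mul_self, Matrix.mul_zero]
    have hxC : projR G.M * projR G.A * G.C = 0 := by
      rw [Matrix.mul_assoc, ← M, projR_mul_self]
    have x₁₁ : x * projL G.B₁₁ = 0 := by rw [hx, Matrix.mul_assoc, ← A, hxA]
    have x₄₃ : x * projL (G.A₄ * G.A₃) = 0 := by
      rw [← neg_eq_zero, ← Matrix.mul_neg, ← A₄₄, hx, Matrix.mul_assoc, ← C, hxC]
    obtain ⟨v₁, v₂⟩ := mul_of_B₃₃_mul hB₃₃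
    obtain ⟨z, w, hz₁, hz₂, hw, e⟩ := mul_leftPart_mul_of_B₁₁ c₂ x₁₁ v₁
    obtain ⟨z', hz', e'⟩ := mul_rightPart_mul_of_A₄_mul_A₃ (v := projL G.B₃₃) x₄₃
    -- The signs make `z A₂ - z' A₄ A₃ = x - x` and `-B₁ w + B₂ v` vanish, where `v` is `L_{B₃₃}`.
    have := mul_mul_eq_zero_of_rank r₁₂₃₄ (u := fromCols z (-z'))
      (v := fromRows (-w) (projL G.B₃₃))
      (by simp [fromCols_mul_fromBlocks, hz₁, hz₂, hz'])
      (by simp [fromBlocks_mul_fromRows, hw, v₂])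
    rw [fromCols_mul_fromBlocks, fromCols_mul_fromRows] at this
    have h2 : projR G.M * projR G.A * G.E = x * G.E₁ * projL G.B₃₃ := by
      simp only [E, hx, Matrix.mul_assoc]
    rw [h2, E₁_eq, Matrix.mul_sub, Matrix.sub_mul, e, e', ← neg_eq_zero, ← this]
    simp only [Matrix.mul_zero, add_zero, Matrix.add_mul, Matrix.neg_mul, Matrix.mul_neg]
    abel
  · obtain ⟨x₂, x₃⟩ := mul_projL_of_mul_A₃₃ hA₃₃
    set v := projL G.B₃₃ * projL G.B * projL G.N with hv
    have v₂ : G.B₂ * v = 0 := by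
      rw [hv, ← Matrix.mul_assoc, ← Matrix.mul_assoc, ← B, mul_projL_self, Matrix.zero_mul]
    have v₃ : G.B₃ * v = 0 := by
      rw [hv, ← Matrix.mul_assoc, ← Matrix.mul_assoc, ← D, ← N, mul_projL_self]
    obtain ⟨z, hz, e⟩ := mul_leftPart_mul_of_B₂ x₂ v₂
    obtain ⟨z', hz', e'⟩ := mul_rightPart_mul_of_B₃ c₃ x₃ v₃
    have := mul_mul_eq_zero_of_rank r₂₃ (u := fromCols z (-z')) (v := v)
      (by simp [fromCols_mul_fromRows, hz, hz'])
      (by rw [fromRows_mul, v₂, v₃, fromRows_zero])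
    rw [fromCols_mul_fromRows] at this
    have h2 : G.E * projL G.B * projL G.N = projR G.A₃₃ * G.E₁ * v := by
      simp only [E, hv, Matrix.mul_assoc]
    rw [h2, E₁_eq, Matrix.mul_sub, Matrix.sub_mul, e, e', ← neg_eq_zero, ← this]
    simp only [Matrix.add_mul, Matrix.neg_mul]
    abel
  · set x := projR G.A * projR G.A₃₃ with hx
    have hxA : x * G.A₃₃ = 0 := by rw [hx, Matrix.mul_assoc, hA₃₃, Matrix.mul_zero]
    have x₃ := (mul_projL_of_mul_A₃₃ hxA).2
    have x₁₁ : x * projL G.B₁₁ = 0 := by rw [hx, Matrix.mul_assoc, ← A, projR_mul_self]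
    set v := projL G.B₃₃ * projL G.D with hv
    have hBv : G.B₃₃ * v = 0 := by rw [hv, mul_projL_self_assoc]
    have v₁ := (mul_of_B₃₃_mul hBv).1
    have v₃ : G.B₃ * v = 0 := by rw [hv, ← Matrix.mul_assoc, ← D, mul_projL_self]
    obtain ⟨z, w, hz₁, hz₂, hw, e⟩ := mul_leftPart_mul_of_B₁₁ c₂ x₁₁ v₁
    obtain ⟨z', hz', e'⟩ := mul_rightPart_mul_of_B₃ c₃ x₃ v₃
    have := mul_mul_eq_zero_of_rank r₁₂₃ (u := fromCols z (-z')) (v := fromRows (-w) v)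
      (by simp [fromCols_mul_fromBlocks, hz₁, hz₂, hz'])
      (by simp [fromBlocks_mul_fromRows, hw, v₃])
    rw [fromCols_mul_fromBlocks, fromCols_mul_fromRows] at this
    have h2 : projR G.A * G.E * projL G.D = x * G.E₁ * v := by
      simp only [E, hx, hv, Matrix.mul_assoc]
    rw [h2, E₁_eq, Matrix.mul_sub, Matrix.sub_mul, e, e', ← neg_eq_zero, ← this]
    simp only [Matrix.mul_zero, add_zero, Matrix.add_mul, Matrix.neg_mul, Matrix.mul_neg]
    abel
  · set x := projR G.C * projR G.A₃₃ with hx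
    have hxA : x * G.A₃₃ = 0 := by rw [hx, Matrix.mul_assoc, hA₃₃, Matrix.mul_zero]
    have x₂ := (mul_projL_of_mul_A₃₃ hxA).1
    have x₄₃ : x * projL (G.A₄ * G.A₃) = 0 := by
      rw [← neg_eq_zero, ← Matrix.mul_neg, ← A₄₄, hx, Matrix.mul_assoc, ← C, projR_mul_self]
    set v := projL G.B₃₃ * projL G.B with hv
    have hBv : G.B₃₃ * v = 0 := by rw [hv, mul_projL_self_assoc]
    have v₂ : G.B₂ * v = 0 := by rw [hv, ← Matrix.mul_assoc, ← B, mul_projL_self]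
    obtain ⟨z, hz, e⟩ := mul_leftPart_mul_of_B₂ x₂ v₂
    obtain ⟨z', hz', e'⟩ := mul_rightPart_mul_of_A₄_mul_A₃ (v := v) x₄₃
    have := mul_mul_eq_zero_of_rank r₂₃₄ (u := fromCols z (-z')) (v := v)
      (by simp [fromCols_mul_fromRows, hz, hz'])
      (by rw [fromRows_mul, v₂, (mul_of_B₃₃_mul hBv).2, fromRows_zero])
    rw [fromCols_mul_fromRows] at this
    have h2 : projR G.C * G.E * projL G.B = x * G.E₁ * v := by
      simp only [E, hx, hv, Matrix.mul_assoc]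
    rw [h2, E₁_eq, Matrix.mul_sub, Matrix.sub_mul, e, e', ← neg_eq_zero, ← this]
    simp only [Matrix.add_mul, Matrix.neg_mul]
    abel

/-! ### Elimination of the unknowns -/

theorem eq₁_iff {X₁ : Matrix (Fin n₁) (Fin k₁) ℍ[ℝ]} {U₁ : Matrix (Fin p) (Fin q) ℍ[ℝ]}
    {V₁ : Matrix (Fin m₁) (Fin q) ℍ[ℝ]} :
    G.A₁ * X₁ - (-(projR G.A₂ * G.C₂ * pinv G.B₂) + G.A₂ * U₁ + V₁ * projR G.B₂) * G.B₁ = G.C₁ ↔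
      G.A₁ * X₁ - V₁ * G.A₁₁ =
        G.C₁ - projR G.A₂ * G.C₂ * pinv G.B₂ * G.B₁ + G.A₂ * U₁ * G.B₁ := by
  apply eq_iff_eq_of_sub_eq_sub
  simp only [A₁₁, Matrix.add_mul, Matrix.neg_mul, Matrix.mul_assoc]
  abel

/-- The left side is the solvability criterion of the reduced first equation, so `V₁` and `X₁` drop
out and only a constraint on `U₁` remains. -/
theorem eq₁_solvable_iff {U₁ : Matrix (Fin p) (Fin q) ℍ[ℝ]} :
    projR G.A₁ * (G.C₁ - projR G.A₂ * G.C₂ * pinv G.B₂ * G.B₁ + G.A₂ * U₁ * G.B₁) *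
      projL G.A₁₁ = 0 ↔ G.B₁₁ * U₁ * G.C₁₁ = G.D₁₁ := by
  apply eq_iff_eq_of_sub_eq_sub
  simp only [B₁₁, C₁₁, D₁₁, Matrix.mul_add, Matrix.mul_sub, Matrix.add_mul, Matrix.sub_mul,
    Matrix.mul_assoc]
  abel

theorem eq₄_iff {U₂ : Matrix (Fin p) (Fin s) ℍ[ℝ]} {V₂ : Matrix (Fin m₃) (Fin s) ℍ[ℝ]}
    {X₅ : Matrix (Fin m₄) (Fin t) ℍ[ℝ]} :
    G.A₄ * (-(projR G.A₃ * G.C₃ * pinv G.B₃) + G.A₃ * U₂ + V₂ * projR G.B₃) - X₅ * G.B₄ = G.C₄ ↔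
      G.A₄ * G.A₃ * U₂ - X₅ * G.B₄ =
        G.C₄ + G.A₄ * projR G.A₃ * G.C₃ * pinv G.B₃ - G.A₄ * V₂ * projR G.B₃ := by
  apply eq_iff_eq_of_sub_eq_sub
  simp only [Matrix.mul_add, Matrix.mul_neg, Matrix.mul_assoc]
  abel

theorem eq₄_solvable_iff {V₂ : Matrix (Fin m₃) (Fin s) ℍ[ℝ]} :
    projR (G.A₄ * G.A₃) *
      (G.C₄ + G.A₄ * projR G.A₃ * G.C₃ * pinv G.B₃ - G.A₄ * V₂ * projR G.B₃) *
      projL G.B₄ = 0 ↔ G.A₂₂ * V₂ * G.B₂₂ = G.C₂₂ := by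
  rw [eq_comm]
  apply eq_iff_eq_of_sub_eq_sub
  simp only [A₂₂, B₂₂, C₂₂, Matrix.mul_add, Matrix.mul_sub, Matrix.add_mul, Matrix.sub_mul,
    Matrix.mul_assoc]
  abel

/-- Equality of the two expressions for `X₃`, as an equation in `W₁, T₁, W₃, T₄`. -/
theorem eq₃_iff (h : projR G.A₃ * G.C₃ * projL G.B₃ = 0)
    {V₂ : Matrix (Fin m₃) (Fin s) ℍ[ℝ]} {W₁ T₁ : Matrix (Fin p) (Fin k₂) ℍ[ℝ]}
    {W₂ W₃ : Matrix (Fin p) (Fin q) ℍ[ℝ]} {T₄ : Matrix (Fin p) (Fin t) ℍ[ℝ]}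
    {T₆ : Matrix (Fin p) (Fin s) ℍ[ℝ]} :
    pinv G.A₂ * G.C₂ + (pinv G.B₁₁ * G.D₁₁ * pinv G.C₁₁ + projL G.B₁₁ * W₂ + W₃ * projR G.C₁₁) *
        G.B₂ + projL G.A₂ * W₁ =
      pinv G.A₃ * G.C₃ + (pinv (G.A₄ * G.A₃) *
        (G.C₄ + G.A₄ * projR G.A₃ * G.C₃ * pinv G.B₃ - G.A₄ * V₂ * projR G.B₃) + T₄ * G.B₄ +
          projL (G.A₄ * G.A₃) * T₆) * G.B₃ + projL G.A₃ * T₁ ↔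
    G.A₃₃ * fromRows W₁ T₁ + fromCols W₃ T₄ * G.B₃₃ =
      G.E₁ - projL G.B₁₁ * W₂ * G.B₂ - G.A₄₄ * T₆ * G.B₃ := by
  -- This removes `B₃† B₃` as required by `E₁`. The `V₂` term disappears since `R_{B₃} B₃ = 0`, so
  -- the two constraints do not interact.
  have h₁ : projR G.A₃ * (G.C₃ * (pinv G.B₃ * G.B₃)) = projR G.A₃ * G.C₃ := by
    rw [← Matrix.mul_assoc, mul_pinv_mul_of_mul_projL_eq_zero h]
  apply eq_iff_eq_of_sub_eq_sub
  rw [A₃₃, B₃₃, fromCols_mul_fromRows, fromCols_mul_fromRows]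
  simp only [E₁, A₄₄, Matrix.mul_add, Matrix.mul_sub, Matrix.add_mul, Matrix.sub_mul,
    Matrix.mul_neg, Matrix.neg_mul, Matrix.mul_assoc, h₁, projR_mul_self, Matrix.mul_zero]
  abel

theorem eq₃_solvable_iff {W₂ : Matrix (Fin p) (Fin q) ℍ[ℝ]} {T₆ : Matrix (Fin p) (Fin s) ℍ[ℝ]} :
    projR G.A₃₃ * (G.E₁ - projL G.B₁₁ * W₂ * G.B₂ - G.A₄₄ * T₆ * G.B₃) * projL G.B₃₃ = 0 ↔
      G.A * W₂ * G.B + G.C * T₆ * G.D = G.E := by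
  rw [eq_comm]
  apply eq_iff_eq_of_sub_eq_sub
  simp only [A, B, C, D, E, Matrix.mul_sub, Matrix.sub_mul, Matrix.mul_assoc]
  abel

theorem WT₁_eq (F : FreeParameters m₁ m₃ m₄ n₁ p k₁ k₂ q s t) :
    G.WT₁ F = fromRows (G.W₁ F) (G.T₁ F) := by
  have hW : G.W₁ F =
      (fromCols 1 0 : Matrix (Fin p) (Fin p ⊕ Fin p) ℍ[ℝ]) * (G.WT₁ F : Matrix _ _ ℍ[ℝ]) := rfl
  have hT : G.T₁ F =
      (fromCols 0 1 : Matrix (Fin p) (Fin p ⊕ Fin p) ℍ[ℝ]) * (G.WT₁ F : Matrix _ _ ℍ[ℝ]) := rfl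
  rw [hW, hT, ← fromRows_toRows (G.WT₁ F), fromCols_mul_fromRows, fromCols_mul_fromRows]
  simp

theorem WT₃_eq (F : FreeParameters m₁ m₃ m₄ n₁ p k₁ k₂ q s t) :
    G.WT₃ F = fromCols (G.W₃ F) (G.T₄ F) := by
  have hW : G.W₃ F =
      (G.WT₃ F : Matrix _ _ ℍ[ℝ]) * (fromRows 1 0 : Matrix (Fin q ⊕ Fin t) (Fin q) ℍ[ℝ]) := rfl
  have hT : G.T₄ F =
      (G.WT₃ F : Matrix _ _ ℍ[ℝ]) * (fromRows 0 1 : Matrix (Fin q ⊕ Fin t) (Fin t) ℍ[ℝ]) := rfl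
  rw [hW, hT, ← fromCols_toCols (G.WT₃ F), fromCols_mul_fromRows, fromCols_mul_fromRows]
  simp

/-! ### The general solution -/

theorem ProjectorConditions.solX₃_eq_altX₃ (h : G.ProjectorConditions)
    (F : FreeParameters m₁ m₃ m₄ n₁ p k₁ k₂ q s t) : G.solX₃ F = G.altX₃ F := by
  obtain ⟨-, ⟨c₃, -, -⟩, d₁, d₂, d₃, d₄⟩ := h
  have h₁ : G.A * G.W₂ F * G.B + G.C * G.T₆ F * G.D = G.E :=
    (mul_mul_add_mul_mul_iff rfl rfl rfl d₁ d₂ d₃ d₄).2 ⟨F.Z₁, F.Z₂, F.Z₃, F.Z₄, F.Z₅, rfl, rfl⟩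
  have h₂ := (sylvester_add_iff (eq₃_solvable_iff.2 h₁)).2 ⟨F.Z₆, F.Z₇, F.Z₈, rfl, rfl⟩
  exact (eq₃_iff c₃).2 (by rw [← WT₁_eq, ← WT₃_eq]; exact h₂)

theorem ProjectorConditions.isSolution (h : G.ProjectorConditions)
    (F : FreeParameters m₁ m₃ m₄ n₁ p k₁ k₂ q s t) :
    G.IsSolution (G.solX₁ F) (G.solX₂ F) (G.solX₃ F) (G.solX₄ F) (G.solX₅ F) := by
  have h₃ := h.solX₃_eq_altX₃ F
  obtain ⟨⟨c₂, a₁, a₂⟩, ⟨c₃, b₁, b₂⟩, -⟩ := h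
  refine ⟨eq₁_iff.2 ?_, sylvester_param c₂ _ _ _, ?_, eq₄_iff.2 ?_⟩
  · exact sylvester_param (eq₁_solvable_iff.2
      ((mul_mul_eq_iff a₂ a₁).2 ⟨G.W₂ F, G.W₃ F, rfl⟩)) F.W₄ F.W₅ F.W₆
  · rw [h₃]; exact sylvester_param c₃ _ _ _
  · exact sylvester_param (eq₄_solvable_iff.2
      ((mul_mul_eq_iff b₁ b₂).2 ⟨F.T₂, F.T₃, rfl⟩)) (G.T₄ F) F.T₅ (G.T₆ F)

theorem ProjectorConditions.isConsistent (h : G.ProjectorConditions) : G.IsConsistent :=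
  ⟨_, _, _, _, _, h.isSolution ⟨0, 0, 0, 0, 0, 0, 0, 0, 0, 0, 0, 0, 0, 0⟩⟩

/-- The same equivalences, read in the other direction, extract parameters from a given solution.
The nested formulas are then recovered from the inside out: `W₂, T₆`, then the blocks, then `U₁, V₁,
V₂, U₂`. -/
theorem ProjectorConditions.exists_freeParameters (h : G.ProjectorConditions)
    {X₁ : Matrix (Fin n₁) (Fin k₁) ℍ[ℝ]} {X₂ : Matrix (Fin m₁) (Fin q) ℍ[ℝ]}
    {X₃ : Matrix (Fin p) (Fin k₂) ℍ[ℝ]} {X₄ : Matrix (Fin m₃) (Fin s) ℍ[ℝ]}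
    {X₅ : Matrix (Fin m₄) (Fin t) ℍ[ℝ]} (hX : G.IsSolution X₁ X₂ X₃ X₄ X₅) :
    ∃ F : FreeParameters m₁ m₃ m₄ n₁ p k₁ k₂ q s t,
      X₁ = G.solX₁ F ∧ X₂ = G.solX₂ F ∧ X₃ = G.solX₃ F ∧ X₄ = G.solX₄ F ∧ X₅ = G.solX₅ F := by
  obtain ⟨⟨c₂, a₁, a₂⟩, ⟨c₃, b₁, b₂⟩, d₁, d₂, d₃, d₄⟩ := h
  obtain ⟨e₁, e₂, e₃, e₄⟩ := hX
  obtain ⟨U₁, V₁, W₁, hX₃, rfl⟩ := (sylvester_iff c₂).1 e₂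
  obtain ⟨U₂, V₂, T₁, hX₃', rfl⟩ := (sylvester_iff c₃).1 e₃
  rw [eq₁_iff] at e₁
  rw [eq₄_iff] at e₄
  have s₁ := projR_mul_mul_projL_of_sylvester e₁
  have s₄ := projR_mul_mul_projL_of_sylvester e₄
  obtain ⟨W₄, W₅, W₆, hX₁, hV₁⟩ := (sylvester_iff s₁).1 e₁
  obtain ⟨T₄, T₅, T₆, hU₂, hX₅⟩ := (sylvester_iff s₄).1 e₄
  obtain ⟨W₂, W₃, hU₁⟩ := (mul_mul_eq_iff a₂ a₁).1 (eq₁_solvable_iff.1 s₁)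
  obtain ⟨T₂, T₃, hV₂⟩ := (mul_mul_eq_iff b₁ b₂).1 (eq₄_solvable_iff.1 s₄)
  have e₅ : G.A₃₃ * fromRows W₁ T₁ + fromCols W₃ T₄ * G.B₃₃ =
      G.E₁ - projL G.B₁₁ * W₂ * G.B₂ - G.A₄₄ * T₆ * G.B₃ :=
    (eq₃_iff c₃ (V₂ := V₂)).1 (by rw [← hU₁, ← hU₂, ← hX₃, ← hX₃'])
  have s₅ : projR G.A₃₃ * (G.E₁ - projL G.B₁₁ * W₂ * G.B₂ - G.A₄₄ * T₆ * G.B₃) *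
      -- The necessary condition is stated for a difference, hence the negated block row.
      projL G.B₃₃ = 0 := projR_mul_mul_projL_of_sylvester (X := fromRows W₁ T₁)
    (Y := -fromCols W₃ T₄) (by rw [Matrix.neg_mul, sub_neg_eq_add]; exact e₅)
  obtain ⟨Z₆, Z₇, Z₈, hWT₁, hWT₃⟩ := (sylvester_add_iff s₅).1 e₅
  obtain ⟨Z₁, Z₂, Z₃, Z₄, Z₅, hW₂, hT₆⟩ :=
    (mul_mul_add_mul_mul_iff rfl rfl rfl d₁ d₂ d₃ d₄).1 (eq₃_solvable_iff.1 s₅)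
  let F : FreeParameters m₁ m₃ m₄ n₁ p k₁ k₂ q s t :=
    ⟨W₄, W₅, W₆, T₂, T₃, T₅, Z₁, Z₂, Z₃, Z₄, Z₅, Z₆, Z₇, Z₈⟩
  have fW₂ : G.W₂ F = W₂ := hW₂.symm
  have fT₆ : G.T₆ F = T₆ := hT₆.symm
  have fWT₁ : G.WT₁ F = fromRows W₁ T₁ := by rw [WT₁, fW₂, fT₆]; exact hWT₁.symm
  have fWT₃ : G.WT₃ F = fromCols W₃ T₄ := by rw [WT₃, fW₂, fT₆]; exact hWT₃.symm
  have fW₁ := (fromRows_ext_iff _ _ _ _).1 ((WT₁_eq F).symm.trans fWT₁)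
  have fW₃ := (fromCols_ext_iff _ _ _ _).1 ((WT₃_eq F).symm.trans fWT₃)
  have fU₁ : G.U₁ F = U₁ := by rw [SylvesterSystem.U₁, fW₂, fW₃.1]; exact hU₁.symm
  have fV₁ : G.V₁ F = V₁ := by rw [SylvesterSystem.V₁, fU₁]; exact hV₁.symm
  have fV₂ : G.V₂ F = V₂ := hV₂.symm
  have fU₂ : G.U₂ F = U₂ := by
    rw [SylvesterSystem.U₂, fV₂, fW₃.2, fT₆]; exact hU₂.symm
  refine ⟨F, ?_, ?_, ?_, ?_, ?_⟩
  · rw [solX₁, fU₁]; exact hX₁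
  · rw [solX₂, fU₁, fV₁]
  · rw [solX₃, fU₁, fW₁.1]; exact hX₃
  · rw [solX₄, fU₂, fV₂]
  · rw [solX₅, fV₂, fW₃.2]; exact hX₅

theorem tfae (G : SylvesterSystem m₁ m₃ m₄ n₁ p k₁ k₂ q s t) :
    List.TFAE [G.IsConsistent, G.RankConditions, G.ProjectorConditions] := by
  tfae_have 1 → 2 := IsConsistent.rankConditions
  tfae_have 2 → 3 := RankConditions.projectorConditions
  tfae_have 3 → 1 := ProjectorConditions.isConsistent
  tfae_finish

end SylvesterSystem

end QuaternionMatrix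

theorem theorem3p1 {m₁ m₃ m₄ n₁ p k₁ k₂ q s t : ℕ}
    (G : QuaternionMatrix.SylvesterSystem m₁ m₃ m₄ n₁ p k₁ k₂ q s t) :
    List.TFAE [G.IsConsistent, G.RankConditions, G.ProjectorConditions] ∧
    (G.IsConsistent →
      (∀ F : QuaternionMatrix.FreeParameters m₁ m₃ m₄ n₁ p k₁ k₂ q s t, G.solX₃ F = G.altX₃ F) ∧
      ∀ (X₁ : Matrix (Fin n₁) (Fin k₁) ℍ[ℝ]) (X₂ : Matrix (Fin m₁) (Fin q) ℍ[ℝ])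
        (X₃ : Matrix (Fin p) (Fin k₂) ℍ[ℝ]) (X₄ : Matrix (Fin m₃) (Fin s) ℍ[ℝ])
        (X₅ : Matrix (Fin m₄) (Fin t) ℍ[ℝ]),
        G.IsSolution X₁ X₂ X₃ X₄ X₅ ↔
          ∃ F : QuaternionMatrix.FreeParameters m₁ m₃ m₄ n₁ p k₁ k₂ q s t,
            X₁ = G.solX₁ F ∧ X₂ = G.solX₂ F ∧ X₃ = G.solX₃ F ∧
              X₄ = G.solX₄ F ∧ X₅ = G.solX₅ F) := by
  refine ⟨G.tfae, fun hG => ?_⟩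
  have hP := (G.tfae.out 0 2).1 hG
  refine ⟨hP.solX₃_eq_altX₃, fun X₁ X₂ X₃ X₄ X₅ => ⟨hP.exists_freeParameters, ?_⟩⟩
  rintro ⟨F, rfl, rfl, rfl, rfl, rfl⟩
  exact hP.isSolution F
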